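/- Let $S^{2n-1}\subset\mathbb{C}^n$ denote the unit sphere, viewed in $\mathbb{P}^n$ through $z\mapsto[1:z]$. A map of spheres is CR if it is continuously differentiable and satisfies the tangential Cauchy–Riemann equations. A CR map of spheres is rational of degree $d$ if it is the restriction to the sphere of a rational map which, written in lowest terms with a common denominator, has $d$ as the maximum of the degrees of its numerator and its denominator. A monomial map is a map each of whose components is a complex constant (possibly zero) times a monomial with nonnegative exponents. Two maps $f,g\colon S^{2n-1}\to S^{2N-1}$ are spherically equivalent if $f\circ\chi=\tau\circ g$ on $S^{2n-1}$, where $\chi$ and $\tau$ are automorphisms of $\mathbb{P}^n$ and $\mathbb{P}^N$ that preserve $S^{2n-1}$ and $S^{2N-1}$ respectively; maps with different target dimensions are spherically equivalent if they become so after the one with the smaller target dimension is padded by zero components. For $n\ge 2$ and a parameter $t=(t_1,\dots,t_n)\in\mathbb{R}^n$ with $0\le t_1\le t_2\le\dots\le t_n\le 1$ and $t\ne(1,\dots,1)$, let $g_t$ be the map of spheres on $S^{2n-1}$ given by $$g_t(z)=\Bigl(\bigl(\sqrt{t_j}\,z_j\bigr)_{1\le j\le n},\ \bigl(\sqrt{1-t_j}\,z_j^2\bigr)_{1\le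 j\le n},\ \bigl(\sqrt{2-t_j-t_k}\,z_jz_k\bigr)_{1\le j<k\le n}\Bigr).$$ Theorem. Let $n\ge 2$. (a) Let $f\colon S^{2n-1}\to S^{2N-1}$ be a rational CR map of degree $2$. Then $f$ is spherically equivalent to a monomial map $S^{2n-1}\to S^{2N-1}$, and there is exactly one parameter $t$ such that $f$ is spherically equivalent to $g_t$. (b) If $s\ne t$ are two parameters, then $g_s$ and $g_t$ are not spherically equivalent. -/

import Mathlib

open scoped LinearAlgebra.Projectivization

namespace CRSphere

/-- The unit sphere of `ℂ^ι` with the Euclidean norm; for `ι = Fin n` it is `S^{2n-1}`. -/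
abbrev USphere (ι : Type) [Fintype ι] : Type :=
  Metric.sphere (0 : EuclideanSpace ℂ ι) 1

/-- The homogeneous coordinates `(1, z)` of `z ∈ ℂ^ι`. -/
def homogCoord {ι : Type} (z : EuclideanSpace ℂ ι) : Option ι → ℂ :=
  fun o => o.elim 1 (fun i => z i)

theorem homogCoord_ne_zero {ι : Type} (z : EuclideanSpace ℂ ι) : homogCoord z ≠ 0 :=
  fun h => one_ne_zero (congrFun h none)

/-- The standard embedding of `ℂ^ι` into the complex projective space of the same dimension. -/
noncomputable def toProj {ι : Type} (z : EuclideanSpace ℂ ι) : ℙ ℂ (Option ι → ℂ) :=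
  Projectivization.mk ℂ (homogCoord z) (homogCoord_ne_zero z)

section Maps

variable {σ ι κ : Type} [Fintype σ] [Fintype ι] [Fintype κ]

/-- A map of spheres is CR if it is continuously differentiable (it has a `C¹` extension to a
neighbourhood of the sphere) and its differential is complex linear on the complex tangent space
`{v | ⟨z, v⟩ = 0}` of the sphere at each of its points `z`, which is the system of the
tangential Cauchy-Riemann equations. -/
def IsCR (f : USphere σ → USphere ι) : Prop :=
  ∃ (U : Set (EuclideanSpace ℂ σ)) (F : EuclideanSpace ℂ σ → EuclideanSpace ℂ ι),
    IsOpen U ∧ Metric.sphere (0 : EuclideanSpace ℂ σ) 1 ⊆ U ∧ ContDiffOn ℝ 1 F U ∧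
    (∀ z : USphere σ, F z.1 = (f z).1) ∧
    ∀ (z : USphere σ) (v : EuclideanSpace ℂ σ), inner ℂ z.1 v = 0 →
      fderiv ℝ F z.1 (Complex.I • v) = Complex.I • fderiv ℝ F z.1 v

/-- `f` is the restriction to the sphere of a rational map `p / q` of degree `d`, where `p / q` is
in lowest terms and the degree is the maximum of the degrees of the numerator and of the
denominator. It is not required beforehand that `q` has no zeros on the sphere. -/
def IsRationalOfDegree (f : USphere σ → USphere ι) (d : ℕ) : Prop :=
  ∃ (p : ι → MvPolynomial σ ℂ) (q : MvPolynomial σ ℂ),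
    q ≠ 0 ∧
    (∀ r : MvPolynomial σ ℂ, r ∣ q → (∀ i, r ∣ p i) → IsUnit r) ∧
    (∀ (z : USphere σ) (i : ι),
      MvPolynomial.eval (fun j => z.1 j) q * (f z).1 i =
        MvPolynomial.eval (fun j => z.1 j) (p i)) ∧
    max (Finset.univ.sup fun i => (p i).totalDegree) q.totalDegree = d

/-- Every component is a monomial (with a complex coefficient, possibly zero) with nonnegative
exponents. -/
def IsMonomial (f : USphere σ → USphere ι) : Prop :=
  ∀ i : ι, ∃ (c : ℂ) (α : σ → ℕ), ∀ z : USphere σ, (f z).1 i = c * ∏ j, z.1 j ^ α j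

/-- `φ` is the restriction to the sphere of an automorphism of the projective space which maps the
sphere onto itself. -/
def IsSphereAut (φ : USphere ι ≃ USphere ι) : Prop :=
  ∃ L : (Option ι → ℂ) ≃ₗ[ℂ] (Option ι → ℂ),
    ∀ z : USphere ι,
      Projectivization.map L.toLinearMap L.injective (toProj z.1) = toProj (φ z).1

/-- Spherical equivalence of two maps with the same source and the same target. -/
def SphEquivSameTarget (f g : USphere σ → USphere ι) : Prop :=
  ∃ (χ : USphere σ ≃ USphere σ) (τ : USphere ι ≃ USphere ι),
    IsSphereAut χ ∧ IsSphereAut τ ∧ f ∘ χ = τ ∘ g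

/-- Extension of a vector by zero components. -/
noncomputable def zeroExtend (e : ι ↪ κ) (w : USphere ι) : USphere κ :=
  ⟨WithLp.toLp 2 (Function.extend e (fun i => w.1 i) 0), by
    have hw : ‖w.1‖ = 1 := by simp
    rw [mem_sphere_zero_iff_norm]
    refine Eq.trans ?_ hw
    rw [EuclideanSpace.norm_eq, EuclideanSpace.norm_eq]
    congr 1
    symm
    refine Fintype.sum_of_injective e e.injective _ _ ?_ ?_
    · intro k hk
      have : ¬ ∃ i, e i = k := fun ⟨i, hi⟩ => hk ⟨i, hi⟩
      simp [Function.extend_apply' _ _ _ this]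
    · intro i
      simp [e.injective.extend_apply]⟩

/-- Spherical equivalence of two maps with the same source and possibly different targets: the
map with the smaller target dimension is padded by zero components. -/
def SphericallyEquivalent (f : USphere σ → USphere ι) (g : USphere σ → USphere κ) : Prop :=
  (∃ e : ι ↪ κ, SphEquivSameTarget (fun z => zeroExtend e (f z)) g) ∨
  (∃ e : κ ↪ ι, SphEquivSameTarget f (fun z => zeroExtend e (g z)))

end Maps

/-- Parameters `0 ≤ t₁ ≤ ⋯ ≤ tₙ ≤ 1`, not all equal to `1`. -/
abbrev Param (n : ℕ) : Type :=
  {t : Fin n → ℝ // Monotone t ∧ (∀ j, 0 ≤ t j ∧ t j ≤ 1) ∧ ∃ j, t j ≠ 1}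

/-- The components of the maps of the family: `z_j`, `z_j²`, and `z_j z_k` with `j < k`. -/
abbrev FamilyIndex (n : ℕ) : Type :=
  Fin n ⊕ Fin n ⊕ {p : Fin n × Fin n // p.1 < p.2}

/-- The vector with the components `√t_j z_j`, `√(1 - t_j) z_j²` and
`√(2 - t_j - t_k) z_j z_k`, `j < k`. -/
noncomputable def familyVec {n : ℕ} (t : Fin n → ℝ) (z : EuclideanSpace ℂ (Fin n)) :
    EuclideanSpace ℂ (FamilyIndex n) :=
  WithLp.toLp 2 <| Sum.elim (fun j => (√(t j) : ℂ) * z j) <|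
    Sum.elim (fun j => (√(1 - t j) : ℂ) * z j ^ 2)
      (fun p => (√(2 - t p.1.1 - t p.1.2) : ℂ) * (z p.1.1 * z p.1.2))

theorem sum_lt_identity {n : ℕ} (a x : Fin n → ℝ) :
    ∑ j, a j * x j ^ 2 + ∑ p : {p : Fin n × Fin n // p.1 < p.2},
      (a p.1.1 + a p.1.2) * (x p.1.1 * x p.1.2) = (∑ j, a j * x j) * ∑ k, x k := by
  have h1 : ∑ p : {p : Fin n × Fin n // p.1 < p.2},
      (a p.1.1 + a p.1.2) * (x p.1.1 * x p.1.2)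
      = ∑ j, ∑ k, if j < k then (a j + a k) * (x j * x k) else 0 := by
    rw [← Finset.sum_product', Finset.univ_product_univ, ← Finset.sum_filter]
    exact (Finset.sum_subtype _ (by simp)
      (fun p : Fin n × Fin n => (a p.1 + a p.2) * (x p.1 * x p.2))).symm
  have h2 : ∀ j k : Fin n, (if j < k then (a j + a k) * (x j * x k) else 0)
      = (if j < k then a j * x j * x k else 0) + (if j < k then a k * x k * x j else 0) := by
    intro j k; split_ifs <;> ring
  rw [h1, Finset.sum_mul_sum]
  simp only [h2, Finset.sum_add_distrib]
  rw [Finset.sum_comm (f := fun j k : Fin n => if j < k then a k * x k * x j else 0)]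
  have h3 : ∀ j : Fin n, a j * x j ^ 2 = ∑ k, if j = k then a j * x j * x k else 0 := by
    intro j; simp; ring
  simp only [h3, ← Finset.sum_add_distrib]
  refine Finset.sum_congr rfl fun j _ => Finset.sum_congr rfl fun k _ => ?_
  rcases lt_trichotomy j k with h | h | h
  · simp [h, h.ne, h.not_gt]
  · simp [h]
  · simp [h, h.ne', h.not_gt]

theorem familyVec_mem {n : ℕ} (t : Fin n → ℝ) (ht : ∀ j, 0 ≤ t j ∧ t j ≤ 1)
    (z : USphere (Fin n)) :
    familyVec t z.1 ∈ Metric.sphere (0 : EuclideanSpace ℂ (FamilyIndex n)) 1 := by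
  have hz : ∑ j, ‖z.1 j‖ ^ 2 = 1 := by
    have hw : ‖z.1‖ = 1 := by simp
    rw [← EuclideanSpace.norm_sq_eq, hw, one_pow]
  rw [mem_sphere_zero_iff_norm]
  have key : ‖familyVec t z.1‖ ^ 2 = 1 := by
    rw [EuclideanSpace.norm_sq_eq, Fintype.sum_sum_type, Fintype.sum_sum_type]
    have e1 : ∀ j, ‖familyVec t z.1 (Sum.inl j)‖ ^ 2 = t j * ‖z.1 j‖ ^ 2 := by
      intro j
      simp [familyVec, mul_pow, Real.sq_sqrt (ht j).1]
    have e2 : ∀ j, ‖familyVec t z.1 (Sum.inr (Sum.inl j))‖ ^ 2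
        = (1 - t j) * (‖z.1 j‖ ^ 2) ^ 2 := by
      intro j
      have : 0 ≤ 1 - t j := by linarith [(ht j).2]
      simp [familyVec, mul_pow, Real.sq_sqrt this]
    have e3 : ∀ p : {p : Fin n × Fin n // p.1 < p.2},
        ‖familyVec t z.1 (Sum.inr (Sum.inr p))‖ ^ 2
        = ((1 - t p.1.1) + (1 - t p.1.2)) * (‖z.1 p.1.1‖ ^ 2 * ‖z.1 p.1.2‖ ^ 2) := by
      intro p
      have : 0 ≤ 2 - t p.1.1 - t p.1.2 := by linarith [(ht p.1.1).2, (ht p.1.2).2]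
      simp only [familyVec, Sum.elim_inr, norm_mul, mul_pow, Complex.norm_real,
        Real.norm_eq_abs, sq_abs, Real.sq_sqrt this]
      ring
    simp only [e1, e2, e3]
    rw [sum_lt_identity (fun j => 1 - t j) (fun j => ‖z.1 j‖ ^ 2), hz, mul_one,
      ← Finset.sum_add_distrib]
    refine Eq.trans ?_ hz
    exact Finset.sum_congr rfl fun j _ => by ring
  exact (pow_eq_one_iff_of_nonneg (norm_nonneg _) two_ne_zero).1 key

/-- The map of spheres `z ↦ (√t_j z_j, √(1 - t_j) z_j², √(2 - t_j - t_k) z_j z_k)`. -/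
noncomputable def familyMap {n : ℕ} (t : Param n) (z : USphere (Fin n)) :
    USphere (FamilyIndex n) :=
  ⟨familyVec t.1 z.1, familyVec_mem t.1 t.2.2.1 z⟩

end CRSphere

open CRSphere

/-! In homogeneous coordinates the source and target spheres are the projectivized null cones of
Hermitian forms `lorentz` of signatures (1, n) and (1, N). A rational map of degree 2 lifts to a
quadratic map x ↦ B x x which sends null vectors to null vectors; lowest terms and degree exactly 2
become the irreducibility condition `IsIrred` (`exists_quadratic_lift`). The whole argument concerns
the Gram kernel ⟨B x x, B y y⟩.

The kernel vanishes whenever x ⟂ y, hence it is divisible by the form: ⟨B x x, B y y⟩ = ⟨x, y⟩ A(x,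
y) with A Hermitian (`exists_quotient_form`). The target has only one positive direction, so a
timelike vector and a nonzero non-spacelike vector are never orthogonal. Together with
irreducibility this forces A > 0 on nonzero null vectors (`IsQuotient.pos_of_null`). Then the ratio
of A to the form attains a minimum over timelike vectors, and a minimizer is a timelike eigenvector;
so A and the form are diagonalized simultaneously by an element of U(1, n), that is, by an
automorphism of the source sphere. Signature again bounds the eigenvalues, and A becomes a positive
multiple of diag(1, 1 - t_1, ..., 1 - t_n) (`IsQuotient.exists_param`), which is the quotient form
of the family map (`lorentz_familyVec`).

Conversely, Gram kernels determine maps into a sphere up to a target automorphism, by a case of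
Witt's theorem (`exists_isSphereAut_of_gram_eq`). This gives the equivalence with the family map,
and with a monomial map into the same target, because a count of orthogonal vectors shows that the
nonzero components of the family map fit into N dimensions (`IsQuotient.card_le`).

For uniqueness, an equivalence of two family maps yields a linear map which carries one quotient
form to a multiple of the other and the Lorentz form to a multiple of itself (`eq_smul_paramForm`).
The diagonal operators representing the two quotient forms are then conjugate up to a positive
factor, and comparing spectra recovers the ordered parameter (`Param.eq_of_conj`). -/

namespace CRSphere

open scoped ComplexConjugate

/-! ### The Hermitian form of signature (1, n) and its isometries. -/

section Lorentz

/-- The first standard basis vector. -/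
noncomputable def timeVec (ι : Type) : Option ι → ℂ := fun o => o.elim 1 fun _ => 0

@[simp] theorem timeVec_none {ι : Type} : timeVec ι none = 1 := rfl
@[simp] theorem timeVec_some {ι : Type} (i : ι) : timeVec ι (some i) = 0 := rfl

variable {ι : Type} [Fintype ι]

/-- The Hermitian form of signature `(1, card ι)` on the space of homogeneous coordinates. -/
noncomputable def lorentz : (Option ι → ℂ) →ₗ[ℂ] (Option ι → ℂ) →ₗ⋆[ℂ] ℂ :=
  LinearMap.mk₂'ₛₗ (RingHom.id ℂ) (starRingEnd ℂ)
    (fun x y => x none * conj (y none) - ∑ i, x (some i) * conj (y (some i)))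
    (fun x x' y => by
      simp only [Pi.add_apply, add_mul, Finset.sum_add_distrib]; ring)
    (fun c x y => by
      simp only [Pi.smul_apply, smul_eq_mul, RingHom.id_apply, mul_sub, Finset.mul_sum, mul_assoc])
    (fun x y y' => by
      simp only [Pi.add_apply, map_add, mul_add, Finset.sum_add_distrib]; ring)
    (fun c x y => by
      simp only [Pi.smul_apply, smul_eq_mul, map_mul, mul_sub, Finset.mul_sum,
        mul_left_comm])

theorem lorentz_apply (x y : Option ι → ℂ) :
    lorentz x y = x none * conj (y none) - ∑ i, x (some i) * conj (y (some i)) := rfl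

theorem conj_lorentz (x y : Option ι → ℂ) : conj (lorentz x y) = lorentz y x := by
  simp [lorentz_apply, mul_comm]

theorem lorentz_self (x : Option ι → ℂ) :
    lorentz x x = ((‖x none‖ ^ 2 - ∑ i, ‖x (some i)‖ ^ 2 : ℝ) : ℂ) := by
  simp [lorentz_apply, Complex.mul_conj']

theorem lorentz_self_re (x : Option ι → ℂ) :
    (lorentz x x).re = ‖x none‖ ^ 2 - ∑ i, ‖x (some i)‖ ^ 2 := by
  rw [lorentz_self, Complex.ofReal_re]

theorem ofReal_lorentz_self_re (x : Option ι → ℂ) :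
    (((lorentz x x).re : ℝ) : ℂ) = lorentz x x := by
  rw [lorentz_self, Complex.ofReal_re]

theorem lorentz_eq_zero_symm {x y : Option ι → ℂ} (h : lorentz x y = 0) : lorentz y x = 0 := by
  rw [← conj_lorentz, h, map_zero]

@[simp] theorem lorentz_timeVec_right (x : Option ι → ℂ) : lorentz x (timeVec ι) = x none := by
  simp [lorentz_apply]

@[simp] theorem lorentz_timeVec_left (x : Option ι → ℂ) :
    lorentz (timeVec ι) x = conj (x none) := by
  simp [lorentz_apply]

theorem eq_zero_of_none_eq_zero {x : Option ι → ℂ} (h : 0 ≤ (lorentz x x).re)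
    (h0 : x none = 0) : x = 0 := by
  rw [lorentz_self_re, h0] at h
  have h1 : ∑ i, ‖x (some i)‖ ^ 2 = 0 :=
    le_antisymm (by simpa using h) (Finset.sum_nonneg fun i _ => by positivity)
  rw [Finset.sum_eq_zero_iff_of_nonneg (fun i _ => by positivity)] at h1
  funext o
  cases o with
  | none => exact h0
  | some i => simpa using h1 i (Finset.mem_univ i)

/-- The combination in question has time coordinate 0, and by orthogonality its square is a
nonnegative combination of those of `a` and `b`. The form is negative definite on such vectors, so
the combination vanishes. This is the only way in which the single positive direction is used. -/
theorem smul_eq_smul_of_orthogonal {a b : Option ι → ℂ} (hab : lorentz a b = 0)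
    (ha : 0 ≤ (lorentz a a).re) (hb : 0 ≤ (lorentz b b).re) : b none • a = a none • b := by
  rw [← sub_eq_zero]
  refine eq_zero_of_none_eq_zero ?_ (by simp [mul_comm])
  have hba := lorentz_eq_zero_symm hab
  have : lorentz (b none • a - a none • b) (b none • a - a none • b)
      = ((‖b none‖ ^ 2 * (lorentz a a).re + ‖a none‖ ^ 2 * (lorentz b b).re : ℝ) : ℂ) := by
    push_cast
    rw [ofReal_lorentz_self_re, ofReal_lorentz_self_re, ← Complex.mul_conj', ← Complex.mul_conj']
    simp only [map_sub, map_smul, LinearMap.sub_apply, LinearMap.smul_apply, map_smulₛₗ,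
      smul_eq_mul, hab, hba]
    ring
  rw [this, Complex.ofReal_re]
  positivity

theorem eq_zero_of_orthogonal_of_pos {a b : Option ι → ℂ} (hab : lorentz a b = 0)
    (ha : 0 < (lorentz a a).re) (hb : 0 ≤ (lorentz b b).re) : b = 0 := by
  have h := smul_eq_smul_of_orthogonal hab ha.le hb
  have ha0 : a none ≠ 0 := fun h0 => by
    have := eq_zero_of_none_eq_zero ha.le h0
    simp [this] at ha
  have h1 : b none * lorentz a a = 0 := by
    have := congrArg (fun x => lorentz x a) h
    simpa [lorentz_eq_zero_symm hab] using this
  have h2 : lorentz a a ≠ 0 := fun h0 => by simp [h0] at ha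
  exact eq_zero_of_none_eq_zero hb ((mul_eq_zero.1 h1).resolve_right h2)

theorem lorentz_neg_of_orthogonal {a b : Option ι → ℂ} (hab : lorentz a b = 0)
    (ha : 0 < (lorentz a a).re) (hb : b ≠ 0) : (lorentz b b).re < 0 := by
  by_contra h
  exact hb (eq_zero_of_orthogonal_of_pos hab ha (not_lt.1 h))

theorem eq_zero_of_lorentz_eq_zero {x : Option ι → ℂ} (h : ∀ y, lorentz x y = 0) : x = 0 := by
  classical
  funext o
  cases o with
  | none => simpa using h (timeVec ι)
  | some i => simpa [lorentz_apply, Pi.single_apply] using h (Pi.single (some i) 1)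

theorem exists_lorentz_ne_zero {x : Option ι → ℂ} (hx : x ≠ 0) : ∃ y, lorentz x y ≠ 0 := by
  by_contra! h
  exact hx (eq_zero_of_lorentz_eq_zero h)

/-- The group of linear automorphisms preserving the form acts transitively on the vectors of
square norm `1`. -/
theorem exists_isometry_timeVec {u : Option ι → ℂ} (hu : lorentz u u = 1) :
    ∃ S : (Option ι → ℂ) ≃ₗ[ℂ] (Option ι → ℂ),
      (∀ x y, lorentz (S x) (S y) = lorentz x y) ∧ S (timeVec ι) = u := by
  have hu0 : u none ≠ 0 := fun h0 => by
    have := eq_zero_of_none_eq_zero (x := u) (by simp [hu]) h0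
    simp [this] at hu
  set r : ℝ := ‖u none‖ with hr
  have hr0 : (r : ℂ) ≠ 0 := by simpa [hr] using hu0
  have hcc : u none * conj (u none) = (r : ℂ) ^ 2 := by rw [hr, Complex.mul_conj']
  -- Removing the phase of `u none` makes the product of the vector with `timeVec` real, which is
  -- needed for the reflection along their difference to exchange them.
  set c : ℂ := u none / r with hc
  have hcn : c * conj c = 1 := by
    rw [hc, map_div₀, Complex.conj_ofReal]; field_simp; rw [hcc]
  have hc0 : c ≠ 0 := fun h => by simp [h] at hcn
  set v : Option ι → ℂ := conj c • u with hv
  have hv0 : v none = r := by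
    rw [hv, Pi.smul_apply, smul_eq_mul, hc, map_div₀, Complex.conj_ofReal]
    field_simp
    rw [mul_comm, hcc]
  have hvv : lorentz v v = 1 := by
    simp only [hv, map_smul, LinearMap.smul_apply, map_smulₛₗ, smul_eq_mul, hu, Complex.conj_conj]
    rw [mul_one]; linear_combination hcn
  set d : Option ι → ℂ := v - timeVec ι with hd
  have hdd : lorentz d d = 2 - 2 * r := by
    simp [hd, hvv, hv0]; ring
  have hed : lorentz (timeVec ι) d = r - 1 := by
    simp [hd, hv0]
  have key : ∃ S : (Option ι → ℂ) ≃ₗ[ℂ] (Option ι → ℂ),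
      (∀ x y, lorentz (S x) (S y) = lorentz x y) ∧ S (timeVec ι) = v := by
    by_cases h1 : (r : ℂ) = 1
    · refine ⟨LinearEquiv.refl ℂ _, fun x y => rfl, ?_⟩
      have : d = 0 := by
        refine eq_zero_of_none_eq_zero (by simp [hdd, h1]) (by simp [hd, hv0, h1])
      exact (sub_eq_zero.1 this).symm
    · have hdne : lorentz d d ≠ 0 := by
        rw [hdd]; intro h; apply h1; linear_combination -h / 2
      set k : ℂ := 2 / lorentz d d with hk
      have hkd : k * lorentz d d = 2 := by rw [hk]; field_simp
      have hkr : conj k = k := by rw [hk, map_div₀, conj_lorentz, map_ofNat]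
      -- The reflection along `d = v - timeVec`; it exists because `d` is not null when `r ≠ 1`.
      let R : (Option ι → ℂ) →ₗ[ℂ] (Option ι → ℂ) :=
        LinearMap.id - k • (lorentz.flip d).smulRight d
      have hR : ∀ x, R x = x - (k * lorentz x d) • d := fun x => by
        simp [R, mul_smul]
      have hRR : ∀ x, R (R x) = x := fun x => by
        simp only [hR, map_sub, map_smul, LinearMap.sub_apply, LinearMap.smul_apply, smul_eq_mul]
        rw [sub_sub, ← add_smul]
        have : k * lorentz x d + k * (lorentz x d - k * lorentz x d * lorentz d d) = 0 := by
          linear_combination (- k * lorentz x d) * hkd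
        rw [this, zero_smul, sub_zero]
      refine ⟨LinearEquiv.ofInvolutive R hRR, fun x y => ?_, ?_⟩
      · change lorentz (R x) (R y) = _
        have h3 : lorentz d y = conj (lorentz y d) := (conj_lorentz _ _).symm
        simp only [hR, map_sub, map_smul, LinearMap.sub_apply, LinearMap.smul_apply, map_smulₛₗ,
          smul_eq_mul, map_mul, hkr, h3]
        linear_combination (k * lorentz x d * conj (lorentz y d)) * hkd
      · change R (timeVec ι) = _
        rw [hR, hed]
        have : k * (r - 1) = -1 := by
          rw [hdd] at hkd; linear_combination -hkd / 2
        rw [this, hd]; simp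
  obtain ⟨S, hS, hSe⟩ := key
  refine ⟨S.trans (LinearEquiv.smulOfNeZero ℂ _ c hc0), fun x y => ?_, ?_⟩
  · change lorentz (c • S x) (c • S y) = _
    simp only [map_smul, LinearMap.smul_apply, map_smulₛₗ, smul_eq_mul, hS]
    linear_combination lorentz x y * hcn
  · change c • S (timeVec ι) = u
    rw [hSe, hv, smul_smul, hcn, one_smul]

end Lorentz

/-! ### Points of the sphere as null lines; sphere automorphisms as linear similarities. -/

section Lift

variable {ι : Type}

@[simp] theorem homogCoord_none (z : EuclideanSpace ℂ ι) : homogCoord z none = 1 := rfl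
@[simp] theorem homogCoord_some (z : EuclideanSpace ℂ ι) (i : ι) :
    homogCoord z (some i) = z i := rfl

theorem homogCoord_injective : Function.Injective (homogCoord (ι := ι)) := fun z w h => by
  ext i
  exact congrFun h (some i)

theorem exists_lift_of_none_ne_zero {x : Option ι → ℂ} (h0 : x none ≠ 0) :
    ∃ z : EuclideanSpace ℂ ι, x = x none • homogCoord z := by
  refine ⟨WithLp.toLp 2 fun i => x (some i) / x none, ?_⟩
  funext o
  cases o with
  | none => simp
  | some i => simp; field_simp

variable [Fintype ι]

theorem lorentz_homogCoord (x y : EuclideanSpace ℂ ι) :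
    lorentz (homogCoord x) (homogCoord y) = 1 - ∑ i, x i * conj (y i) := by
  simp [lorentz_apply]

theorem lorentz_homogCoord_self (x : EuclideanSpace ℂ ι) :
    lorentz (homogCoord x) (homogCoord x) = ((1 - ‖x‖ ^ 2 : ℝ) : ℂ) := by
  rw [lorentz_self, EuclideanSpace.norm_sq_eq]
  simp

theorem lorentz_lift_self (z : USphere ι) :
    lorentz (homogCoord z.1) (homogCoord z.1) = 0 := by
  rw [lorentz_homogCoord_self, mem_sphere_zero_iff_norm.1 z.2]
  simp

theorem none_ne_zero_of_null {x : Option ι → ℂ} (hx : lorentz x x = 0) (h0 : x ≠ 0) :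
    x none ≠ 0 := fun h => h0 (eq_zero_of_none_eq_zero (by simp [hx]) h)

theorem exists_lift_of_null {x : Option ι → ℂ} (hx : lorentz x x = 0) (h0 : x ≠ 0) :
    ∃ z : USphere ι, x = x none • homogCoord z.1 := by
  have hn := none_ne_zero_of_null hx h0
  obtain ⟨z, hz⟩ := exists_lift_of_none_ne_zero hn
  refine ⟨⟨z, ?_⟩, hz⟩
  have h1 : x none * (conj (x none) * lorentz (homogCoord z) (homogCoord z)) = 0 := by
    rw [hz] at hx
    simpa using hx
  have h2 : lorentz (homogCoord z) (homogCoord z) = 0 := by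
    simpa [hn] using h1
  rw [lorentz_homogCoord_self, Complex.ofReal_eq_zero] at h2
  rw [mem_sphere_zero_iff_norm]
  exact (pow_eq_one_iff_of_nonneg (norm_nonneg _) two_ne_zero).1 (by linarith)

theorem eq_of_lorentz_lift_eq_zero {z w : USphere ι}
    (h : lorentz (homogCoord z.1) (homogCoord w.1) = 0) : z = w := by
  have := smul_eq_smul_of_orthogonal h (by simp [lorentz_lift_self]) (by simp [lorentz_lift_self])
  simp only [homogCoord_none, one_smul] at this
  exact Subtype.ext (homogCoord_injective this)

theorem eq_of_smul_lift_eq {z w : USphere ι} {c : ℂ}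
    (h : homogCoord z.1 = c • homogCoord w.1) : z = w := by
  refine eq_of_lorentz_lift_eq_zero ?_
  rw [h]
  simp [lorentz_lift_self]

/-- A linear automorphism preserving the form induces an automorphism of the sphere. -/
theorem exists_isSphereAut (L : (Option ι → ℂ) ≃ₗ[ℂ] (Option ι → ℂ))
    (hL : ∀ x y, lorentz (L x) (L y) = lorentz x y) :
    ∃ φ : USphere ι ≃ USphere ι, IsSphereAut φ ∧
      ∀ z, ∃ c : ℂ, c ≠ 0 ∧ L (homogCoord z.1) = c • homogCoord (φ z).1 := by
  have step : ∀ (M : (Option ι → ℂ) ≃ₗ[ℂ] (Option ι → ℂ)),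
      (∀ x y, lorentz (M x) (M y) = lorentz x y) → ∀ z : USphere ι,
      ∃ w : USphere ι, ∃ c : ℂ, c ≠ 0 ∧ M (homogCoord z.1) = c • homogCoord w.1 := by
    intro M hM z
    have h0 : M (homogCoord z.1) ≠ 0 := by simpa using homogCoord_ne_zero z.1
    have h1 : lorentz (M (homogCoord z.1)) (M (homogCoord z.1)) = 0 := by
      rw [hM, lorentz_lift_self]
    obtain ⟨w, hw⟩ := exists_lift_of_null h1 h0
    exact ⟨w, _, none_ne_zero_of_null h1 h0, hw⟩
  have hL' : ∀ x y, lorentz (L.symm x) (L.symm y) = lorentz x y := fun x y => by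
    rw [← hL, L.apply_symm_apply, L.apply_symm_apply]
  choose f cf hcf hf using step L hL
  choose g cg hcg hg using step L.symm hL'
  have hgf : ∀ z, g (f z) = z := fun z => by
    have h := congrArg L.symm (hf z)
    rw [L.symm_apply_apply, map_smul, hg, smul_smul] at h
    exact (eq_of_smul_lift_eq h).symm
  have hfg : ∀ z, f (g z) = z := fun z => by
    have h := congrArg L (hg z)
    rw [L.apply_symm_apply, map_smul, hf, smul_smul] at h
    exact (eq_of_smul_lift_eq h).symm
  refine ⟨⟨f, g, hgf, hfg⟩, ⟨L, fun z => ?_⟩, fun z => ⟨cf z, hcf z, hf z⟩⟩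
  rw [toProj, Projectivization.map_mk, toProj, Projectivization.mk_eq_mk_iff']
  exact ⟨cf z, (hf z).symm⟩

/-- A sesquilinear form which vanishes on the null cone is a multiple of the Lorentz form. -/
theorem eq_smul_lorentz_of_null (C : (Option ι → ℂ) →ₗ[ℂ] (Option ι → ℂ) →ₗ⋆[ℂ] ℂ)
    (hC : ∀ z : USphere ι, C (homogCoord z.1) (homogCoord z.1) = 0) (x y : Option ι → ℂ) :
    C x y = C (timeVec ι) (timeVec ι) * lorentz x y := by
  set m := C (timeVec ι) (timeVec ι) with hm
  set D : (Option ι → ℂ) →ₗ[ℂ] (Option ι → ℂ) →ₗ⋆[ℂ] ℂ := C - m • lorentz with hD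
  have hDa : ∀ x y, D x y = C x y - m * lorentz x y := fun x y => by simp [hD]
  have hD0 : ∀ v, lorentz v v = 0 → D v v = 0 := by
    intro v hv
    by_cases h : v = 0
    · simp [h]
    · obtain ⟨z, hz⟩ := exists_lift_of_null hv h
      rw [hz, hDa]
      simp [hC, lorentz_lift_self]
  have hee : D (timeVec ι) (timeVec ι) = 0 := by rw [hDa]; simp [hm]
  have hunit : ∀ v : Option ι → ℂ, v none = 0 → lorentz v v = -1 →
      D (timeVec ι) v = 0 ∧ D v (timeVec ι) = 0 ∧ D v v = 0 := by
    intro v h0 hv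
    -- For a unit spacelike `v` orthogonal to `timeVec` all vectors `timeVec + u • v` with |u| = 1
    -- are null. The values u = 1, -1, i separate the Fourier coefficients in u.
    have key : ∀ u : ℂ, u * conj u = 1 →
        conj u * D (timeVec ι) v + u * D v (timeVec ι) + D v v = 0 := by
      intro u hu
      have := hD0 (timeVec ι + u • v) (by
        simp [h0, hv]; linear_combination -hu)
      simp only [map_add, map_smul, LinearMap.add_apply, LinearMap.smul_apply, map_smulₛₗ,
        smul_eq_mul, hee] at this
      linear_combination this - D v v * hu
    have k1 := key 1 (by simp)
    have k2 := key (-1) (by simp)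
    have k3 := key Complex.I (by simp)
    simp only [map_one, map_neg, Complex.conj_I] at k1 k2 k3
    have hI := Complex.I_mul_I
    have e3 : D v v = 0 := by linear_combination (k1 + k2) / 2
    have e1 : D (timeVec ι) v = 0 := by
      linear_combination (k1 - k2) / 4 + Complex.I / 2 * (k3 - e3) +
        (D (timeVec ι) v - D v (timeVec ι)) / 2 * hI
    exact ⟨e1, by linear_combination k1 - e3 - e1, e3⟩
  have hspace : ∀ v : Option ι → ℂ, v none = 0 →
      D (timeVec ι) v = 0 ∧ D v (timeVec ι) = 0 ∧ D v v = 0 := by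
    intro v h0
    by_cases hv : v = 0
    · simp [hv]
    have hneg : (lorentz v v).re < 0 :=
      lorentz_neg_of_orthogonal (a := timeVec ι) (by simp [h0]) (by simp) hv
    set r : ℝ := √(-(lorentz v v).re) with hr
    have hr0 : (r : ℂ) ≠ 0 := by
      rw [Complex.ofReal_ne_zero]; exact (Real.sqrt_pos.2 (by linarith)).ne'
    have hr2 : (r : ℂ) * r = - lorentz v v := by
      rw [← ofReal_lorentz_self_re v, ← Complex.ofReal_mul, hr,
        Real.mul_self_sqrt (by linarith)]; simp
    obtain ⟨h1, h2, h3⟩ := hunit ((r : ℂ)⁻¹ • v) (by simp [h0]) (by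
      simp only [map_smul, LinearMap.smul_apply, map_smulₛₗ, smul_eq_mul, map_inv₀,
        Complex.conj_ofReal]
      field_simp
      linear_combination hr2)
    simp only [map_smul, LinearMap.smul_apply, map_smulₛₗ, smul_eq_mul, map_inv₀,
        Complex.conj_ofReal, mul_eq_zero, inv_eq_zero, hr0, false_or] at h1 h2 h3
    exact ⟨h1, h2, h3⟩
  have hdiag : ∀ v, D v v = 0 := by
    intro v
    obtain ⟨w, hw0, hw⟩ : ∃ w : Option ι → ℂ, w none = 0 ∧ v = v none • timeVec ι + w :=
      ⟨v - v none • timeVec ι, by simp, by simp⟩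
    obtain ⟨h1, h2, h3⟩ := hspace w hw0
    rw [hw]
    simp only [map_add, map_smul, LinearMap.add_apply, LinearMap.smul_apply, map_smulₛₗ,
      smul_eq_mul, hee, h1, h2, h3]
    ring
  have hxy : D x y = 0 := by
    have h1 := hdiag (x + y)
    have h2 := hdiag (x + Complex.I • y)
    simp only [map_add, map_smul, LinearMap.add_apply, LinearMap.smul_apply, map_smulₛₗ,
      smul_eq_mul, hdiag, Complex.conj_I] at h1 h2
    have hI := Complex.I_mul_I
    linear_combination h1 / 2 + Complex.I / 2 * h2 + (D x y - D y x) / 2 * hI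
  rw [hDa] at hxy
  linear_combination hxy

/-- The pullback of a sesquilinear form along a linear map. -/
noncomputable def pullbackForm {V W : Type} [AddCommGroup V] [Module ℂ V] [AddCommGroup W]
    [Module ℂ W] (C : W →ₗ[ℂ] W →ₗ⋆[ℂ] ℂ) (L : V →ₗ[ℂ] W) : V →ₗ[ℂ] V →ₗ⋆[ℂ] ℂ :=
  (C ∘ₗ L).compl₂ L

@[simp] theorem pullbackForm_apply {V W : Type} [AddCommGroup V] [Module ℂ V] [AddCommGroup W]
    [Module ℂ W] (C : W →ₗ[ℂ] W →ₗ⋆[ℂ] ℂ) (L : V →ₗ[ℂ] W) (x y : V) :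
    pullbackForm C L x y = C (L x) (L y) := rfl

/-- The pullback of the form by the linear map vanishes on null lines, so it is a multiple of the
form. The factor `m` is real as a diagonal value of a Hermitian form; its sign is not decided here.
-/
theorem IsSphereAut.exists_linear {φ : USphere ι ≃ USphere ι} (hφ : IsSphereAut φ) :
    ∃ (L : (Option ι → ℂ) ≃ₗ[ℂ] (Option ι → ℂ)) (m : ℝ), m ≠ 0 ∧
      (∀ x y, lorentz (L x) (L y) = m * lorentz x y) ∧
      ∀ z, ∃ c : ℂ, c ≠ 0 ∧ L (homogCoord z.1) = c • homogCoord (φ z).1 := by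
  obtain ⟨L, hL⟩ := hφ
  have hz : ∀ z, ∃ c : ℂ, c ≠ 0 ∧ L (homogCoord z.1) = c • homogCoord (φ z).1 := by
    intro z
    have h := hL z
    rw [toProj, Projectivization.map_mk, toProj, Projectivization.mk_eq_mk_iff'] at h
    obtain ⟨c, hc⟩ := h
    refine ⟨c, ?_, hc.symm⟩
    rintro rfl
    rw [zero_smul] at hc
    exact homogCoord_ne_zero z.1 (L.injective (by simpa using hc.symm))
  have hform := eq_smul_lorentz_of_null
    (pullbackForm lorentz L.toLinearMap) (fun z => by
      obtain ⟨c, -, h⟩ := hz z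
      simp [h, lorentz_lift_self])
  simp only [pullbackForm_apply, LinearEquiv.coe_coe] at hform
  refine ⟨L, (lorentz (L (timeVec ι)) (L (timeVec ι))).re, ?_, ?_, hz⟩
  · intro h0
    have h1 : lorentz (L (timeVec ι)) (L (timeVec ι)) = 0 := by
      rw [← ofReal_lorentz_self_re, h0, Complex.ofReal_zero]
    have h2 := hform (L.symm (timeVec ι)) (L.symm (timeVec ι))
    simp [h1] at h2
  · intro x y
    rw [ofReal_lorentz_self_re]
    exact hform x y

theorem IsSphereAut.symm {φ : USphere ι ≃ USphere ι} (hφ : IsSphereAut φ) :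
    IsSphereAut φ.symm := by
  obtain ⟨L, -, -, -, hz⟩ := hφ.exists_linear
  refine ⟨L.symm, fun z => ?_⟩
  obtain ⟨c, hc, h⟩ := hz (φ.symm z)
  rw [toProj, Projectivization.map_mk, toProj, Projectivization.mk_eq_mk_iff']
  refine ⟨c⁻¹, ?_⟩
  rw [φ.apply_symm_apply] at h
  have := congrArg L.symm h
  rw [L.symm_apply_apply, map_smul] at this
  rw [this, smul_smul, inv_mul_cancel₀ hc, one_smul]
  rfl

theorem IsSphereAut.trans {φ ψ : USphere ι ≃ USphere ι} (hφ : IsSphereAut φ)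
    (hψ : IsSphereAut ψ) : IsSphereAut (φ.trans ψ) := by
  obtain ⟨L, -, -, -, hz⟩ := hφ.exists_linear
  obtain ⟨M, -, -, -, hw⟩ := hψ.exists_linear
  refine ⟨L.trans M, fun z => ?_⟩
  obtain ⟨c, hc, h⟩ := hz z
  obtain ⟨d, hd, h'⟩ := hw (φ z)
  rw [toProj, Projectivization.map_mk, toProj, Projectivization.mk_eq_mk_iff']
  refine ⟨c * d, ?_⟩
  change _ = M (L _)
  rw [h, map_smul, h', smul_smul]
  rfl

end Lift

/-! ### Vectors and maps determined by Gram kernels: a case of Witt's theorem. -/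

section Witt

/-- Two families of vectors with the same Gram matrix are related by a linear isometry. -/
theorem exists_linearIsometryEquiv_of_inner_eq {X E : Type*} [NormedAddCommGroup E]
    [InnerProductSpace ℂ E] [FiniteDimensional ℂ E] (F G : X → E)
    (h : ∀ x y, inner ℂ (F x) (F y) = inner ℂ (G x) (G y)) :
    ∃ U : E ≃ₗᵢ[ℂ] E, ∀ x, U (G x) = F x := by
  classical
  set Φ := Finsupp.linearCombination ℂ F
  set Ψ := Finsupp.linearCombination ℂ G
  have hnorm : ∀ a, ‖Φ a‖ = ‖Ψ a‖ := by
    intro a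
    have : inner ℂ (Φ a) (Φ a) = inner ℂ (Ψ a) (Ψ a) := by
      simp only [Φ, Ψ, Finsupp.linearCombination_apply, Finsupp.sum, sum_inner, inner_sum,
        inner_smul_left, inner_smul_right, h]
    rw [inner_self_eq_norm_sq_to_K, inner_self_eq_norm_sq_to_K] at this
    have h2 : ‖Φ a‖ ^ 2 = ‖Ψ a‖ ^ 2 := by exact_mod_cast this
    exact (pow_left_inj₀ (norm_nonneg _) (norm_nonneg _) two_ne_zero).1 h2
  -- By `hnorm`, Ψ a ↦ Φ a is a well defined isometry on the range of Ψ; the section `s` picks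
  -- representatives.
  obtain ⟨s, hs⟩ := Ψ.rangeRestrict.exists_rightInverse_of_surjective Ψ.range_rangeRestrict
  have hs' : ∀ y : LinearMap.range Ψ, Ψ (s y) = y := fun y =>
    congrArg Subtype.val (LinearMap.congr_fun hs y)
  let l : LinearMap.range Ψ →ₗᵢ[ℂ] E := ⟨Φ ∘ₗ s, fun y => by
    rw [LinearMap.comp_apply, hnorm, hs']; rfl⟩
  refine ⟨LinearIsometryEquiv.ofSurjective l.extend
    (LinearMap.surjective_of_injective (f := l.extend.toLinearMap) l.extend.injective), fun x => ?_⟩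
  have hx : G x = ((⟨G x, ⟨Finsupp.single x 1, by simp [Ψ]⟩⟩ : LinearMap.range Ψ) : E) := rfl
  change l.extend (G x) = F x
  rw [hx, LinearIsometry.extend_apply]
  change Φ (s _) = F x
  have hF : F x = Φ (Finsupp.single x 1) := by simp [Φ]
  rw [hF, ← sub_eq_zero, ← map_sub, ← norm_eq_zero, hnorm, norm_eq_zero, map_sub, hs']
  simp [Ψ]

variable {κ X : Type}

/-- The last coordinates of a vector of homogeneous coordinates. -/
noncomputable def spacePart (v : Option κ → ℂ) : EuclideanSpace ℂ κ :=
  WithLp.toLp 2 fun i => v (some i)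

theorem ext_spacePart {v w : Option κ → ℂ} (h0 : v none = w none)
    (h1 : spacePart v = spacePart w) : v = w := by
  funext o
  cases o with
  | none => exact h0
  | some i => exact congrArg (fun y : EuclideanSpace ℂ κ => y i) h1

variable [Fintype κ]

theorem inner_spacePart (x y : Option κ → ℂ) :
    inner ℂ (spacePart x) (spacePart y) = y none * conj (x none) - lorentz y x := by
  simp [spacePart, PiLp.inner_apply, lorentz_apply]

theorem exists_isometry_spacePart (U : EuclideanSpace ℂ κ ≃ₗᵢ[ℂ] EuclideanSpace ℂ κ) :
    ∃ T : (Option κ → ℂ) ≃ₗ[ℂ] (Option κ → ℂ),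
      (∀ x y, lorentz (T x) (T y) = lorentz x y) ∧ (∀ v, T v none = v none) ∧
      ∀ v, spacePart (T v) = U (spacePart v) := by
  let mk : (EuclideanSpace ℂ κ ≃ₗᵢ[ℂ] EuclideanSpace ℂ κ) →
      (Option κ → ℂ) →ₗ[ℂ] (Option κ → ℂ) := fun W =>
    { toFun := fun v o => o.elim (v none) fun i => W (spacePart v) i
      map_add' := fun v w => by
        funext o
        cases o with
        | none => rfl
        | some i =>
          have : spacePart (v + w) = spacePart v + spacePart w := rfl
          simp [this]
      map_smul' := fun c v => by
        funext o
        cases o with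
        | none => rfl
        | some i =>
          have : spacePart (c • v) = c • spacePart v := rfl
          simp [this] }
  have hmk : ∀ W v, spacePart (mk W v) = W (spacePart v) := fun W v => rfl
  let T : (Option κ → ℂ) ≃ₗ[ℂ] (Option κ → ℂ) := LinearEquiv.ofLinearMap (mk U) (mk U.symm)
    (LinearMap.ext fun v => ext_spacePart rfl (by simp [hmk]))
    (LinearMap.ext fun v => ext_spacePart rfl (by simp [hmk]))
  have hTn : ∀ v, T v none = v none := fun v => rfl
  refine ⟨T, fun x y => ?_, hTn, fun v => rfl⟩
  have h1 : inner ℂ (spacePart (T y)) (spacePart (T x)) = inner ℂ (spacePart y) (spacePart x) :=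
    U.inner_map_map _ _
  rw [inner_spacePart, inner_spacePart, hTn, hTn] at h1
  linear_combination -h1

/-- A special case of Witt's theorem: two families with the same Gram matrix, where the
span contains a vector of positive square, are related by an isometry. -/
theorem exists_isometry_of_lorentz_eq (F G : X → Option κ → ℂ)
    (h : ∀ x y, lorentz (F x) (F y) = lorentz (G x) (G y)) {a b : X}
    (ha : lorentz (G a) (G a) = 0) (hab : lorentz (G a) (G b) ≠ 0) :
    ∃ L : (Option κ → ℂ) ≃ₗ[ℂ] (Option κ → ℂ),
      (∀ x y, lorentz (L x) (L y) = lorentz x y) ∧ ∀ x, L (G x) = F x := by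
  have hba : lorentz (G b) (G a) ≠ 0 := fun h0 => hab (lorentz_eq_zero_symm h0)
  set β := lorentz (G b) (G b) with hβ
  have hβr : conj β = β := conj_lorentz _ _
  -- Since `G a` is null, the square of `s • G a + G b` is 2 Re(s ⟨G a, G b⟩) + β; this `s` makes it
  -- equal to 1.
  obtain ⟨s, hs⟩ : ∃ s : ℂ, s = (1 - β) / (2 * lorentz (G a) (G b)) := ⟨_, rfl⟩
  have hs1 : s * lorentz (G a) (G b) = (1 - β) / 2 := by rw [hs]; field_simp
  have hs2 : conj s * lorentz (G b) (G a) = (1 - β) / 2 := by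
    rw [← conj_lorentz (G a), ← map_mul, hs1, map_div₀, map_sub, map_one, hβr, map_ofNat]
  have hu : ∀ P : X → Option κ → ℂ, (∀ x y, lorentz (P x) (P y) = lorentz (G x) (G y)) →
      lorentz (s • P a + P b) (s • P a + P b) = 1 := by
    intro P hP
    simp only [map_add, map_smul, LinearMap.add_apply, LinearMap.smul_apply, map_smulₛₗ,
      smul_eq_mul, hP, ha]
    linear_combination hs1 + hs2 - hβ
  obtain ⟨S, hS, hSe⟩ := exists_isometry_timeVec (hu G fun _ _ => rfl)
  obtain ⟨R, hR, hRe⟩ := exists_isometry_timeVec (hu F h)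
  have hS' : ∀ x y, lorentz (S.symm x) (S.symm y) = lorentz x y := fun x y => by
    rw [← hS, S.apply_symm_apply, S.apply_symm_apply]
  have hR' : ∀ x y, lorentz (R.symm x) (R.symm y) = lorentz x y := fun x y => by
    rw [← hR, R.apply_symm_apply, R.apply_symm_apply]
  -- Once the unit timelike combinations of both families are moved to `timeVec`, time coordinates
  -- are products with these combinations and hence agree. What is left is a comparison of Gram
  -- matrices in the Euclidean space parts.
  have hnone : ∀ x, (R.symm (F x)) none = (S.symm (G x)) none := by
    intro x
    rw [← lorentz_timeVec_right (R.symm (F x)), ← lorentz_timeVec_right (S.symm (G x)), ← hR, R.apply_symm_apply, hRe,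
      ← hS (S.symm (G x)), S.apply_symm_apply, hSe]
    simp only [map_add, map_smulₛₗ, h]
  obtain ⟨U, hU⟩ := exists_linearIsometryEquiv_of_inner_eq
    (fun x => spacePart (R.symm (F x))) (fun x => spacePart (S.symm (G x))) (fun x y => by
      rw [inner_spacePart, inner_spacePart, hR', hS', h, hnone, hnone])
  obtain ⟨T, hT, hTn, hTs⟩ := exists_isometry_spacePart U
  refine ⟨(S.symm.trans T).trans R, fun x y => ?_, fun x => ?_⟩
  · change lorentz (R (T (S.symm x))) (R (T (S.symm y))) = _
    rw [hR, hT, hS']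
  · change R (T (S.symm (G x))) = F x
    rw [← R.eq_symm_apply]
    exact ext_spacePart ((hTn _).trans (hnone x).symm) ((hTs _).trans (hU x))

/-- Two maps into a sphere whose Gram kernels agree up to a rescaling of the lifts differ by an
automorphism of the sphere. -/
theorem exists_isSphereAut_of_gram_eq (F G : X → USphere κ) (c : X → ℂ) (hc : ∀ x, c x ≠ 0)
    (h : ∀ x y, c x * conj (c y) * lorentz (homogCoord (F x).1) (homogCoord (F y).1) =
      lorentz (homogCoord (G x).1) (homogCoord (G y).1)) {a b : X} (hab : G a ≠ G b) :
    ∃ τ : USphere κ ≃ USphere κ, IsSphereAut τ ∧ ∀ x, F x = τ (G x) := by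
  obtain ⟨L, hL, hLG⟩ := exists_isometry_of_lorentz_eq (fun x => c x • homogCoord (F x).1)
    (fun x => homogCoord (G x).1) (fun x y => by
      rw [← h]
      simp only [map_smul, LinearMap.smul_apply, map_smulₛₗ, smul_eq_mul]
      ring) (a := a) (b := b) (lorentz_lift_self _) (fun h0 => hab (eq_of_lorentz_lift_eq_zero h0))
  obtain ⟨τ, hτ, hτL⟩ := exists_isSphereAut L hL
  refine ⟨τ, hτ, fun x => ?_⟩
  obtain ⟨d, hd, h1⟩ := hτL (G x)
  have h2 := hLG x
  rw [h1] at h2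
  refine eq_of_smul_lift_eq (c := (c x)⁻¹ * d) ?_
  rw [mul_smul, h2, smul_smul, inv_mul_cancel₀ (hc x), one_smul]

end Witt

/-! ### Divisibility of the Gram kernel of a quadratic map by the Lorentz form. -/

section Division

variable {σ ι : Type} [Fintype σ] [Fintype ι]

theorem exists_quadratic_pos {a : ℝ} (ha : 0 < a) (b c : ℝ) :
    ∃ t₀ : ℝ, ∀ t, t₀ ≤ t → 0 < a * t ^ 2 + b * t + c := by
  refine ⟨1 + (|b| + |c|) / a, fun t ht => ?_⟩
  have h1 : 0 ≤ (|b| + |c|) / a := by positivity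
  have ht1 : 1 ≤ t := by linarith
  have h2 : a + (|b| + |c|) ≤ a * t := by
    have := mul_le_mul_of_nonneg_left ht ha.le
    rwa [mul_add, mul_one, mul_div_cancel₀ _ ha.ne'] at this
  nlinarith [neg_abs_le b, neg_abs_le c, abs_nonneg b, abs_nonneg c,
    mul_le_mul_of_nonneg_right h2 (by linarith : (0 : ℝ) ≤ t),
    mul_nonneg (abs_nonneg c) (by linarith : (0 : ℝ) ≤ t - 1),
    mul_nonneg (by linarith [neg_abs_le b] : 0 ≤ |b| + b) (by linarith : (0 : ℝ) ≤ t)]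

variable {B : (Option σ → ℂ) →ₗ[ℂ] (Option σ → ℂ) →ₗ[ℂ] (Option ι → ℂ)}

/-- After scaling `w` by a real `s`, the vector z + u s w is null for every |u| = 1. The square of
its image is a trigonometric polynomial in u which vanishes identically, and ⟨B z z, B w w⟩ is, up
to s², its coefficient at conj u². -/
theorem orthogonal_of_pos_neg (hB : ∀ x y, B x y = B y x)
    (hnull : ∀ x, lorentz x x = 0 → lorentz (B x x) (B x x) = 0) {z w : Option σ → ℂ}
    (hzw : lorentz z w = 0) (hz : 0 < (lorentz z z).re) (hw : (lorentz w w).re < 0) :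
    lorentz (B z z) (B w w) = 0 := by
  set s : ℝ := √((lorentz z z).re / -(lorentz w w).re) with hs
  have hs0 : (s : ℂ) ≠ 0 := by
    rw [Complex.ofReal_ne_zero]
    exact (Real.sqrt_pos.2 (div_pos hz (by linarith))).ne'
  have hs2 : (s : ℂ) * s * lorentz w w = - lorentz z z := by
    rw [← ofReal_lorentz_self_re w, ← ofReal_lorentz_self_re z, ← Complex.ofReal_mul, hs,
      Real.mul_self_sqrt (div_nonneg hz.le (by linarith)), ← Complex.ofReal_mul,
      ← Complex.ofReal_neg]
    congr 1
    have := hw.ne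
    field_simp
  have hwz := lorentz_eq_zero_symm hzw
  have key : ∀ u : ℂ, u * conj u = 1 → lorentz
      (B z z + (2 * (u * s)) • B z w + (u * s) ^ 2 • B w w)
      (B z z + (2 * (u * s)) • B z w + (u * s) ^ 2 • B w w) = 0 := by
    intro u hu
    have := hnull (z + (u * s) • w) (by
      simp only [map_add, map_smul, LinearMap.add_apply, LinearMap.smul_apply, map_smulₛₗ,
        smul_eq_mul, hzw, hwz, map_mul, Complex.conj_ofReal]
      linear_combination hs2 + s * s * lorentz w w * hu)
    have h2 : B (z + (u * s) • w) (z + (u * s) • w) =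
        B z z + (2 * (u * s)) • B z w + (u * s) ^ 2 • B w w := by
      simp only [map_add, map_smul, LinearMap.add_apply, LinearMap.smul_apply, hB w z]
      module
    rwa [h2] at this
  have hI := Complex.I_mul_I
  have k1 := key 1 (by simp)
  have k2 := key (-1) (by simp)
  have k3 := key Complex.I (by simp)
  have k4 := key (-Complex.I) (by simp)
  -- Averaging over ±u removes the odd frequencies. The points 1 and i only give the sum α + α'; the
  -- point (3 + 4i)/5, whose square is not real, separates α from α'.
  have k5 := key (3 / 5 + 4 / 5 * Complex.I) (by
    simp only [map_add, map_mul, map_div₀, map_ofNat, Complex.conj_I]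
    linear_combination (-16 / 25) * hI)
  have k6 := key (-(3 / 5 + 4 / 5 * Complex.I)) (by
    simp only [map_add, map_mul, map_div₀, map_ofNat, Complex.conj_I, map_neg]
    linear_combination (-16 / 25) * hI)
  simp only [map_add, map_smul, LinearMap.add_apply, LinearMap.smul_apply, map_smulₛₗ,
    smul_eq_mul, map_mul, map_pow, map_neg, map_one, map_div₀, map_ofNat, Complex.conj_ofReal,
    Complex.conj_I] at k1 k2 k3 k4 k5 k6
  set α := lorentz (B z z) (B w w)
  set α' := lorentz (B w w) (B z z)
  set K := lorentz (B z z) (B z z) + 4 * s ^ 2 * lorentz (B z w) (B z w) +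
    s ^ 4 * lorentz (B w w) (B w w) with hK
  have q1 : K + s ^ 2 * (α + α') = 0 := by rw [hK]; linear_combination (k1 + k2) / 2
  have q2 : K - s ^ 2 * (α + α') = 0 := by
    rw [hK]
    have hI3 : Complex.I ^ 3 = - Complex.I := by rw [pow_succ, Complex.I_sq]; ring
    have hI4 : Complex.I ^ 4 = 1 := by simp
    ring_nf at k3 k4
    simp only [Complex.I_sq, hI3, hI4] at k3 k4
    linear_combination (k3 + k4) / 2
  have q3 : K + s ^ 2 * ((-7 - 24 * Complex.I) / 25 * α + (-7 + 24 * Complex.I) / 25 * α') = 0 := by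
    rw [hK]
    have hI3 : Complex.I ^ 3 = - Complex.I := by rw [pow_succ, Complex.I_sq]; ring
    have hI4 : Complex.I ^ 4 = 1 := by simp
    ring_nf at k5 k6
    simp only [Complex.I_sq, hI3, hI4] at k5 k6
    linear_combination (k5 + k6) / 2
  have hα : s ^ 2 * Complex.I * α = 0 := by
    linear_combination (-25 / 48) * (q3 - (q1 + q2) / 2) +
      ((-7 + 24 * Complex.I) / 25) * (25 / 48) * (q1 - q2) / 2
  simpa [hs0] using hα

/-- Choose a timelike `p` orthogonal to `w`. For large real t the vector z + t p is timelike and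
still orthogonal to `w`, so the timelike case applies; the resulting expression is affine in t, and
its constant term is the claim. -/
theorem orthogonal_of_neg (hB : ∀ x y, B x y = B y x)
    (hnull : ∀ x, lorentz x x = 0 → lorentz (B x x) (B x x) = 0) {z w : Option σ → ℂ}
    (hzw : lorentz z w = 0) (hw : (lorentz w w).re < 0) :
    lorentz (B z z) (B w w) = 0 := by
  have hw0 : lorentz w w ≠ 0 := fun h => by simp [h] at hw
  obtain ⟨p, hpw, hp⟩ : ∃ p, lorentz p w = 0 ∧ 0 < (lorentz p p).re := by
    have hpw : lorentz (timeVec σ - (lorentz (timeVec σ) w / lorentz w w) • w) w = 0 := by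
      simp only [map_sub, map_smul, LinearMap.sub_apply, LinearMap.smul_apply, smul_eq_mul]
      field_simp
      ring
    refine ⟨_, hpw, ?_⟩
    rw [map_sub, map_smulₛₗ, hpw, smul_zero, sub_zero, lorentz_timeVec_right]
    simp only [Pi.sub_apply, timeVec_none, Pi.smul_apply, smul_eq_mul, lorentz_timeVec_left]
    rw [div_mul_eq_mul_div, mul_comm, Complex.mul_conj', ← ofReal_lorentz_self_re,
      ← Complex.ofReal_pow, ← Complex.ofReal_div, Complex.sub_re, Complex.one_re,
      Complex.ofReal_re]
    have : ‖w none‖ ^ 2 / (lorentz w w).re ≤ 0 := div_nonpos_of_nonneg_of_nonpos (by positivity) hw.le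
    linarith
  have hpp := orthogonal_of_pos_neg hB hnull hpw hp hw
  obtain ⟨t₀, ht₀⟩ := exists_quadratic_pos hp (lorentz z p + lorentz p z).re (lorentz z z).re
  have key : ∀ t : ℝ, t₀ ≤ t →
      lorentz (B z z) (B w w) + 2 * t * lorentz (B z p) (B w w) = 0 := by
    intro t ht
    have hpos : 0 < (lorentz (z + (t : ℂ) • p) (z + (t : ℂ) • p)).re := by
      have : lorentz (z + (t : ℂ) • p) (z + (t : ℂ) • p) =
          (((lorentz p p).re : ℝ) : ℂ) * t ^ 2 + (lorentz z p + lorentz p z) * t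
            + lorentz z z := by
        rw [ofReal_lorentz_self_re]
        simp only [map_add, map_smul, LinearMap.add_apply, LinearMap.smul_apply, map_smulₛₗ,
          smul_eq_mul, Complex.conj_ofReal]
        ring
      rw [this]
      have := ht₀ t ht
      rw [Complex.add_re, Complex.add_re, Complex.re_mul_ofReal, ← Complex.ofReal_pow,
        Complex.re_mul_ofReal, Complex.ofReal_re]
      exact this
    have h1 := orthogonal_of_pos_neg hB hnull
      (z := z + (t : ℂ) • p) (by simp [hzw, hpw]) hpos hw
    simp only [map_add, map_smul, LinearMap.add_apply, LinearMap.smul_apply, smul_eq_mul,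
      hpp, hB p z] at h1
    linear_combination h1
  set u := max t₀ 1
  have h1 := key u (le_max_left _ _)
  have h2 := key (2 * u) (by linarith [le_max_left t₀ 1, le_max_right t₀ 1])
  push_cast at h2
  linear_combination 2 * h1 - h2

/-- If neither vector is spacelike, orthogonality makes them proportional, which leaves only a zero
vector or a null line. -/
theorem orthogonal_of_orthogonal (hB : ∀ x y, B x y = B y x)
    (hnull : ∀ x, lorentz x x = 0 → lorentz (B x x) (B x x) = 0) {z w : Option σ → ℂ}
    (hzw : lorentz z w = 0) : lorentz (B z z) (B w w) = 0 := by
  rcases lt_or_ge (lorentz w w).re 0 with hw | hw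
  · exact orthogonal_of_neg hB hnull hzw hw
  rcases lt_or_ge (lorentz z z).re 0 with hz | hz
  · exact lorentz_eq_zero_symm (orthogonal_of_neg hB hnull (lorentz_eq_zero_symm hzw) hz)
  by_cases hz0 : z none = 0
  · simp [eq_zero_of_none_eq_zero hz hz0]
  have h1 := smul_eq_smul_of_orthogonal hzw hz hw
  obtain ⟨c, rfl⟩ : ∃ c : ℂ, w = c • z := ⟨(z none)⁻¹ * w none, by
    rw [mul_smul, h1, smul_smul, inv_mul_cancel₀ hz0, one_smul]⟩
  rw [map_smulₛₗ, smul_eq_mul, mul_eq_zero] at hzw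
  rcases hzw with hc | hzz
  · simp [(map_eq_zero _).1 hc]
  · simp [hnull z hzz]

/-- Division by the Lorentz form: if the Hermitian form of bidegree `(2, 2)` defined by a quadratic
map vanishes on the null cone, then it is the product of the Lorentz form and a Hermitian form. -/
theorem exists_quotient_form (hB : ∀ x y, B x y = B y x)
    (hnull : ∀ x, lorentz x x = 0 → lorentz (B x x) (B x x) = 0) :
    ∃ A : (Option σ → ℂ) →ₗ[ℂ] (Option σ → ℂ) →ₗ⋆[ℂ] ℂ,
      (∀ x y, conj (A x y) = A y x) ∧
      ∀ x y, lorentz (B x x) (B y y) = lorentz x y * A x y := by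
  set e := timeVec σ with he
  set κ := lorentz (B e e) (B e e) with hκ
  have hκr : conj κ = κ := conj_lorentz _ _
  -- The formula is forced: polarizing ⟨B x x, B y y⟩ = ⟨x, y⟩ A(x, y) at the pairs (e, x), (e, y)
  -- expresses A(x, y) through A(e, e) = κ, A(x, e) and A(e, y), and the last two come from the
  -- pairs (e, x), (e, e) and (e, e), (e, y).
  let A : (Option σ → ℂ) →ₗ[ℂ] (Option σ → ℂ) →ₗ⋆[ℂ] ℂ :=
    LinearMap.mk₂'ₛₗ (RingHom.id ℂ) (starRingEnd ℂ)
      (fun x y => 4 * lorentz (B e x) (B e y)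
        - lorentz x e * (2 * lorentz (B e e) (B e y) - lorentz e y * κ)
        - lorentz e y * (2 * lorentz (B e x) (B e e) - lorentz x e * κ) - lorentz x y * κ)
      (fun x x' y => by simp only [map_add, LinearMap.add_apply]; ring)
      (fun c x y => by
        simp only [map_smul, LinearMap.smul_apply, smul_eq_mul, RingHom.id_apply]; ring)
      (fun x y y' => by simp only [map_add]; ring)
      (fun c x y => by simp only [map_smul, map_smulₛₗ, smul_eq_mul]; ring)
  have hA : ∀ x y, A x y = 4 * lorentz (B e x) (B e y)
        - lorentz x e * (2 * lorentz (B e e) (B e y) - lorentz e y * κ)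
        - lorentz e y * (2 * lorentz (B e x) (B e e) - lorentz x e * κ) - lorentz x y * κ :=
    fun x y => rfl
  refine ⟨A, fun x y => ?_, fun x y => ?_⟩
  · simp only [hA, map_sub, map_mul, conj_lorentz, hκr, map_ofNat]
    ring
  obtain ⟨x', hx', hx⟩ : ∃ w : Option σ → ℂ, w none = 0 ∧ x = x none • e + w :=
    ⟨x - x none • e, by simp [he], by simp⟩
  obtain ⟨y', hy', hy⟩ : ∃ w : Option σ → ℂ, w none = 0 ∧ y = y none • e + w :=
    ⟨y - y none • e, by simp [he], by simp⟩
  have hxe : lorentz x' e = 0 := by simp [he, hx']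
  have hey : lorentz e y' = 0 := by simp [he, hy']
  have hee : lorentz e e = 1 := by simp [he]
  have hEQ := orthogonal_of_orthogonal hB hnull hey
  have hPE := orthogonal_of_orthogonal hB hnull hxe
  set j := lorentz x' y' with hj
  set u := lorentz (B e x') (B y' y') - j * lorentz (B e e) (B e y') with hu
  set v := lorentz (B x' x') (B e y') - j * lorentz (B e x') (B e e) with hv
  set w := lorentz (B x' x') (B y' y') - 4 * j * lorentz (B e x') (B e y') + j ^ 2 * κ with hw
  -- By the choice of `A`, only terms of degree at most one in the time coordinates survive in the
  -- defect.
  have hdiff : ∀ a b : ℂ, lorentz (B (a • e + x') (a • e + x')) (B (b • e + y') (b • e + y')) -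
      lorentz (a • e + x') (b • e + y') * A (a • e + x') (b • e + y') =
      2 * a * u + 2 * conj b * v + w := by
    intro a b
    rw [hA]
    simp only [map_add, map_smul, LinearMap.add_apply, LinearMap.smul_apply, map_smulₛₗ,
      smul_eq_mul, hB x' e, hB y' e, hxe, hey, hee, hEQ, hPE, ← hκ, ← hj]
    rw [hu, hv, hw]
    ring
  have hzero : ∀ a b : ℂ, a * conj b + j = 0 → 2 * a * u + 2 * conj b * v + w = 0 := by
    intro a b hab
    have h0 : lorentz (a • e + x') (b • e + y') = 0 := by
      simp only [map_add, map_smul, LinearMap.add_apply, LinearMap.smul_apply, map_smulₛₗ,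
        smul_eq_mul, hxe, hey, hee, ← hj]
      linear_combination hab
    rw [← hdiff, h0, orthogonal_of_orthogonal hB hnull h0, zero_mul, sub_zero]
  -- The defect vanishes on the set a · conj b = -j. Three points of it suffice to annihilate the
  -- three coefficients, with separate choices for j = 0 (two crossing lines) and j ≠ 0 (a
  -- hyperbola).
  have huvw : u = 0 ∧ v = 0 ∧ w = 0 := by
    by_cases hj0 : j = 0
    · have h1 := hzero 0 0 (by simp [hj0])
      have h2 := hzero 1 0 (by simp [hj0])
      have h3 := hzero 0 1 (by simp [hj0])
      simp only [map_zero, map_one] at h1 h2 h3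
      exact ⟨by linear_combination (h2 - h1) / 2, by linear_combination (h3 - h1) / 2,
        by linear_combination h1⟩
    · have h1 := hzero 1 (-conj j) (by simp)
      have h2 := hzero (-1) (conj j) (by simp)
      have h3 := hzero 2 (-conj j / 2) (by
        simp only [map_neg, map_div₀, Complex.conj_conj, map_ofNat]; ring)
      simp only [map_neg, map_div₀, Complex.conj_conj, map_ofNat] at h1 h2 h3
      have hw0 : w = 0 := by linear_combination (h1 + h2) / 2
      have hv0 : j * v = 0 := by linear_combination (h3 - h1 - (h1 - h2) / 2) / 3
      have hv0 := (mul_eq_zero.1 hv0).resolve_left hj0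
      exact ⟨by linear_combination (h1 - hw0) / 2 + j * hv0, hv0, hw0⟩
  obtain ⟨h1, h2, h3⟩ := huvw
  have := hdiff (x none) (y none)
  rw [← hx, ← hy, h1, h2, h3] at this
  linear_combination this

/-- The relation `⟪B x x, B y y⟫ = ⟪x, y⟫ * A x y` in polarized form. -/
theorem polarized (hB : ∀ x y, B x y = B y x)
    {A : (Option σ → ℂ) →ₗ[ℂ] (Option σ → ℂ) →ₗ⋆[ℂ] ℂ}
    (hA : ∀ x y, lorentz (B x x) (B y y) = lorentz x y * A x y) (a b c d : Option σ → ℂ) :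
    4 * lorentz (B a b) (B c d) = lorentz a c * A b d + lorentz a d * A b c +
      lorentz b c * A a d + lorentz b d * A a c := by
  have h4 : ∀ x y, B (x + y) (x + y) - B (x - y) (x - y) = (4 : ℂ) • B x y := by
    intro x y
    simp only [map_add, map_sub, LinearMap.add_apply, LinearMap.sub_apply, hB y x]
    module
  have h16 : 16 * lorentz (B a b) (B c d) =
      lorentz ((4 : ℂ) • B a b) ((4 : ℂ) • B c d) := by
    simp only [map_smul, LinearMap.smul_apply, map_smulₛₗ, smul_eq_mul, map_ofNat]; ring
  rw [← h4, ← h4] at h16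
  simp only [map_sub (lorentz (ι := ι)), LinearMap.sub_apply, map_sub (lorentz (ι := ι) _), hA]
    at h16
  simp only [map_add, map_sub, LinearMap.add_apply, LinearMap.sub_apply] at h16
  linear_combination h16 / 4

end Division

/-! ### Positivity of the quotient form on null vectors. -/

section Positivity

variable {σ ι : Type} [Fintype σ] [Fintype ι]

theorem ofReal_re_of_hermitian {V : Type} [AddCommGroup V] [Module ℂ V]
    {A : V →ₗ[ℂ] V →ₗ⋆[ℂ] ℂ} (hA : ∀ x y, conj (A x y) = A y x) (x : V) :
    (((A x x).re : ℝ) : ℂ) = A x x :=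
  Complex.conj_eq_iff_re.1 (hA x x)

/-- Where `f` vanishes, translating by `w` leads to a point where it does not; this is how a linear
factor is cancelled below. -/
theorem eq_zero_of_mul_eq_zero {V F G : Type} [AddCommGroup V] [FunLike F V ℂ]
    [AddMonoidHomClass F V ℂ] [FunLike G V ℂ] [AddMonoidHomClass G V ℂ] {f : F} {g : G} {w : V} (hw : f w ≠ 0) (h : ∀ c, f c * g c = 0) (c : V) : g c = 0 := by
  have hgw : g w = 0 := (mul_eq_zero.1 (h w)).resolve_left hw
  by_cases hc : f c = 0
  · have := h (c + w)
    rw [map_add, map_add, hc, zero_add, hgw, add_zero] at this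
    exact (mul_eq_zero.1 this).resolve_left hw
  · exact (mul_eq_zero.1 (h c)).resolve_left hc

/-- Two space coordinates leave room for one linear condition, so source dimension at least 2 enters
here. -/
theorem exists_neg_orthogonal [Nontrivial σ] (v : Option σ → ℂ) :
    ∃ x, lorentz x v = 0 ∧ (lorentz x x).re < 0 := by
  classical
  obtain ⟨i, j, hij⟩ := exists_pair_ne σ
  have key : ∀ a b : ℂ, a * conj (v (some i)) + b * conj (v (some j)) = 0 → (a ≠ 0 ∨ b ≠ 0) →
      ∃ x, lorentz x v = 0 ∧ (lorentz x x).re < 0 := by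
    intro a b hab h0
    refine ⟨Pi.single (some i) a + Pi.single (some j) b, ?_, ?_⟩
    · rw [lorentz_apply]
      simp [Pi.single_apply, add_mul, Finset.sum_add_distrib, hab]
    · refine lorentz_neg_of_orthogonal (a := timeVec σ) (by simp) (by simp) fun h => ?_
      have hi := congrFun h (some i)
      have hj := congrFun h (some j)
      simp [hij, hij.symm] at hi hj
      tauto
  by_cases h : v (some i) = 0
  · exact key 1 0 (by simp [h]) (by simp)
  · exact key (conj (v (some j))) (-conj (v (some i))) (by ring) (by simp [h])

theorem exists_sign_ne_zero {l : (Option σ → ℂ) →ₗ[ℂ] ℂ} (hl : l ≠ 0) {s : ℝ}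
    {w : Option σ → ℂ} (hw : 0 < s * (lorentz w w).re) :
    ∃ c, l c ≠ 0 ∧ 0 < s * (lorentz c c).re := by
  by_cases h : l w = 0
  · obtain ⟨p, hp⟩ : ∃ p, l p ≠ 0 := by
      by_contra! h'
      exact hl (LinearMap.ext h')
    obtain ⟨t, ht⟩ := exists_quadratic_pos hw (s * (lorentz p w + lorentz w p).re)
      (s * (lorentz p p).re)
    refine ⟨p + (t : ℂ) • w, by simpa [h] using hp, ?_⟩
    have : lorentz (p + (t : ℂ) • w) (p + (t : ℂ) • w) =
        lorentz w w * ((t ^ 2 : ℝ) : ℂ) + (lorentz p w + lorentz w p) * (t : ℂ)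
          + lorentz p p := by
      simp only [map_add, map_smul, LinearMap.add_apply, LinearMap.smul_apply, map_smulₛₗ,
        smul_eq_mul, Complex.conj_ofReal]
      push_cast
      ring
    rw [this, Complex.add_re, Complex.add_re, Complex.re_mul_ofReal, Complex.re_mul_ofReal]
    linarith [ht t le_rfl]
  · exact ⟨w, h, hw⟩

variable {B : (Option σ → ℂ) →ₗ[ℂ] (Option σ → ℂ) →ₗ[ℂ] (Option ι → ℂ)}
  {A : (Option σ → ℂ) →ₗ[ℂ] (Option σ → ℂ) →ₗ⋆[ℂ] ℂ}

/-- A quadratic map is irreducible if its components have no common linear factor and are not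
all multiples of its first component. -/
structure IsIrred (B : (Option σ → ℂ) →ₗ[ℂ] (Option σ → ℂ) →ₗ[ℂ] (Option ι → ℂ)) : Prop where
  exists_ne_zero : ∀ l : (Option σ → ℂ) →ₗ[ℂ] ℂ, l ≠ 0 → ∃ x, l x = 0 ∧ B x x ≠ 0
  not_parallel : ∀ (e : Option ι → ℂ) (φ : (Option σ → ℂ) → ℂ), e none ≠ 0 →
    ¬ ∀ x, B x x = φ x • e

/-- `A` is the quotient by the Lorentz form of the Hermitian form of bidegree `(2, 2)` defined by
the quadratic map `B`. -/
structure IsQuotient (B : (Option σ → ℂ) →ₗ[ℂ] (Option σ → ℂ) →ₗ[ℂ] (Option ι → ℂ))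
    (A : (Option σ → ℂ) →ₗ[ℂ] (Option σ → ℂ) →ₗ⋆[ℂ] ℂ) : Prop where
  symm : ∀ x y, B x y = B y x
  herm : ∀ x y, conj (A x y) = A y x
  pol : ∀ a b c d, 4 * lorentz (B a b) (B c d) = lorentz a c * A b d + lorentz a d * A b c +
      lorentz b c * A a d + lorentz b d * A a c

theorem IsQuotient.sq (hQ : IsQuotient B A) (x y : Option σ → ℂ) :
    lorentz (B x x) (B y y) = lorentz x y * A x y := by
  linear_combination hQ.pol x x y y / 4

theorem IsQuotient.eq_zero_symm (hQ : IsQuotient B A) {x y : Option σ → ℂ} (h : A x y = 0) :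
    A y x = 0 := by
  rw [← hQ.herm, h, map_zero]

/-- If the radical contained a hyperplane, A would be A(p, p) |l|². Some b = B x₀ x₀ ≠ 0 with x₀ in
the hyperplane is orthogonal to every B c c, so no B c c is timelike and ⟨c, c⟩ A(c, c) ≤ 0. As ⟨c,
c⟩ takes both signs off the hyperplane, A = 0. Then all B x x are null and orthogonal to b, hence
multiples of b, against irreducibility. -/
theorem IsQuotient.nondegenerate [Nonempty σ] (hQ : IsQuotient B A) (hI : IsIrred B)
    {l : (Option σ → ℂ) →ₗ[ℂ] ℂ} (hl : l ≠ 0) (h : ∀ x, l x = 0 → ∀ y, A x y = 0) : False := by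
  classical
  obtain ⟨x₀, hx₀, hb⟩ := hI.exists_ne_zero l hl
  have horth : ∀ c, lorentz (B x₀ x₀) (B c c) = 0 := fun c => by
    rw [hQ.sq, h x₀ hx₀, mul_zero]
  have hle : ∀ c, (lorentz c c).re * (A c c).re ≤ 0 := by
    intro c
    by_contra! hc
    refine hb (eq_zero_of_orthogonal_of_pos (lorentz_eq_zero_symm (horth c)) ?_
      (by rw [horth]; rfl))
    rw [hQ.sq, ← ofReal_lorentz_self_re, Complex.re_ofReal_mul]
    exact hc
  obtain ⟨p, hp⟩ : ∃ p, l p = 1 := by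
    obtain ⟨q, hq⟩ : ∃ q, l q ≠ 0 := by
      by_contra! h'
      exact hl (LinearMap.ext h')
    exact ⟨(l q)⁻¹ • q, by simp [hq]⟩
  have hApq : ∀ x y, A x y = l x * conj (l y) * A p p := by
    intro x y
    have h1 := h (x - l x • p) (by simp [hp]) y
    have h2 := hQ.eq_zero_symm (h (y - l y • p) (by simp [hp]) p)
    simp only [map_sub, map_smul, LinearMap.sub_apply, LinearMap.smul_apply, map_smulₛₗ,
      smul_eq_mul] at h1 h2
    linear_combination h1 + l x * h2
  have hAre : ∀ c, (A c c).re = ‖l c‖ ^ 2 * (A p p).re := by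
    intro c
    rw [hApq, Complex.mul_conj', ← Complex.ofReal_pow, Complex.re_ofReal_mul]
  have hpp : (A p p).re = 0 := by
    obtain ⟨c, hc, hc'⟩ := exists_sign_ne_zero hl (s := 1) (w := timeVec σ) (by simp)
    obtain ⟨i⟩ := ‹Nonempty σ›
    obtain ⟨d, hd, hd'⟩ := exists_sign_ne_zero hl (s := -1)
      (w := (Pi.single (some i) 1 : Option σ → ℂ)) (by simp [lorentz_apply, Pi.single_apply])
    have hc2 : 0 < ‖l c‖ ^ 2 := by positivity
    have hd2 : 0 < ‖l d‖ ^ 2 := by positivity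
    have h1 := hle c
    have h2 := hle d
    rw [hAre] at h1 h2
    apply le_antisymm
    · by_contra! h3
      have : 0 < (lorentz c c).re * (‖l c‖ ^ 2 * (A p p).re) :=
        mul_pos (by linarith) (mul_pos hc2 h3)
      linarith
    · by_contra! h3
      have : 0 < (lorentz d d).re * (‖l d‖ ^ 2 * (A p p).re) :=
        mul_pos_of_neg_of_neg (by linarith) (mul_neg_of_pos_of_neg hd2 h3)
      linarith
  have hA0 : ∀ x y, A x y = 0 := by
    intro x y
    rw [hApq, ← ofReal_re_of_hermitian hQ.herm, hpp, Complex.ofReal_zero, mul_zero]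
  have hb0 : (B x₀ x₀) none ≠ 0 := none_ne_zero_of_null (horth x₀) hb
  refine hI.not_parallel (B x₀ x₀) (fun x => (B x x) none / (B x₀ x₀) none) hb0 fun x => ?_
  have hs : ∀ y, lorentz (B x x) (B y y) = 0 := fun y => by rw [hQ.sq, hA0, mul_zero]
  have := smul_eq_smul_of_orthogonal (hs x₀) (by simp [hs]) (by simp [horth])
  rw [div_eq_inv_mul, mul_smul, ← this, smul_smul, inv_mul_cancel₀ hb0, one_smul]

/-- If A(v, v) < 0, a spacelike x ⟂ v gives a timelike B v x orthogonal to the null vector B v v. So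
B v v = 0, and pairing B v v with B v w yields ⟨v, w⟩ A(v, v) = 0 for all w. -/
theorem IsQuotient.nonneg_of_null [Nontrivial σ] (hQ : IsQuotient B A) {v : Option σ → ℂ}
    (hv : lorentz v v = 0) (hv0 : v ≠ 0) : 0 ≤ (A v v).re := by
  by_contra! hneg
  obtain ⟨x, hxv, hx⟩ := exists_neg_orthogonal v
  have hvx := lorentz_eq_zero_symm hxv
  have h1 : 4 * lorentz (B v x) (B v x) = lorentz x x * A v v := by
    rw [hQ.pol]; simp [hv, hxv, hvx]
  have hpos : 0 < (lorentz (B v x) (B v x)).re := by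
    rw [← ofReal_lorentz_self_re, ← ofReal_lorentz_self_re x,
      ← ofReal_re_of_hermitian hQ.herm] at h1
    have : 4 * (lorentz (B v x) (B v x)).re = (lorentz x x).re * (A v v).re := by
      exact_mod_cast h1
    nlinarith [mul_pos_of_neg_of_neg hx hneg]
  have h2 : 4 * lorentz (B v x) (B v v) = 0 := by
    rw [hQ.pol]; simp [hv, hxv]
  have h3 : lorentz (B v v) (B v v) = 0 := by rw [hQ.sq, hv, zero_mul]
  have h4 : B v v = 0 := eq_zero_of_orthogonal_of_pos (by simpa using h2) hpos (by simp [h3])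
  obtain ⟨w, hw⟩ := exists_lorentz_ne_zero hv0
  have h5 := hQ.pol v v v w
  have hA0 : A v v ≠ 0 := fun h => by simp [h] at hneg
  have : lorentz v w * A v v = 0 := by
    rw [h4, hv, map_zero, LinearMap.zero_apply] at h5
    linear_combination -h5 / 2
  exact (mul_ne_zero hw hA0) this

/-- Suppose A(v, v) = 0. If B v v = 0, then A(v, ·) = 0 and all B v x are null; their time
coordinate controls them, so a hyperplane lies in the radical of A. If B v v ≠ 0, some spacelike x ⟂
v has B v x = 0, and then A(v, ·) = μ ⟨v, ·⟩. For μ < 0 the vector B x x, and for μ > 0 the vector B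
v w, is timelike and orthogonal to the nonzero null vector B v v; for μ = 0 the hyperplane
orthogonal to v lies in the radical. -/
theorem IsQuotient.ne_zero_of_null [Nontrivial σ] (hQ : IsQuotient B A) (hI : IsIrred B)
    {v : Option σ → ℂ} (hv : lorentz v v = 0) (hv0 : v ≠ 0) : A v v ≠ 0 := by
  intro hA0
  obtain ⟨w, hw⟩ := exists_lorentz_ne_zero hv0
  have hl0 : (lorentz (ι := σ)).flip v ≠ 0 := fun h => by
    have := LinearMap.congr_fun h w
    exact hw (lorentz_eq_zero_symm (by simpa using this))
  have hvv : lorentz (B v v) (B v v) = 0 := by rw [hQ.sq, hv, zero_mul]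
  have hker : (∀ c, A v c = 0) → ∀ x, B v x = 0 → ∀ y, A x y = 0 := by
    intro hAv x hx
    refine eq_zero_of_mul_eq_zero hw fun c => ?_
    have := hQ.pol v x c c
    rw [hx, map_zero, LinearMap.zero_apply, hAv] at this
    linear_combination -this / 2
  by_cases hb : B v v = 0
  · have hAv : ∀ c, A v c = 0 := by
      refine eq_zero_of_mul_eq_zero hw fun c => ?_
      have := hQ.pol v v c c
      rw [hb, map_zero, LinearMap.zero_apply] at this
      linear_combination -this / 4
    have hiso : ∀ x, lorentz (B v x) (B v x) = 0 := by
      intro x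
      have := hQ.pol v x v x
      rw [hv, hAv, hA0, hQ.eq_zero_symm (hAv x)] at this
      linear_combination this / 4
    let l : (Option σ → ℂ) →ₗ[ℂ] ℂ := LinearMap.proj none ∘ₗ B v
    have hlB : ∀ x, l x = 0 → B v x = 0 := fun x hx =>
      eq_zero_of_none_eq_zero (by simp [hiso]) hx
    by_cases hl : l = 0
    · exact hQ.nondegenerate hI hl0 fun x _ => hker hAv x (hlB x (by simp [hl]))
    · exact hQ.nondegenerate hI hl fun x hx => hker hAv x (hlB x hx)
  · have hb0 : (B v v) none ≠ 0 := none_ne_zero_of_null hvv hb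
    -- On the hyperplane orthogonal to `v` every B v x is null and orthogonal to B v v, hence a
    -- multiple of it; γ is the quotient of the time coordinates.
    have hred : ∀ x, lorentz x v = 0 → ∃ γ : ℂ, B v (x - γ • v) = 0 := by
      intro x hx
      have hx' := lorentz_eq_zero_symm hx
      refine ⟨(B v x) none / (B v v) none, eq_zero_of_none_eq_zero ?_ ?_⟩
      · set γ := (B v x) none / (B v v) none
        have := hQ.pol v (x - γ • v) v (x - γ • v)
        simp only [map_sub, map_smul, LinearMap.sub_apply, LinearMap.smul_apply, map_smulₛₗ,
          smul_eq_mul, hx, hx', hv, hA0] at this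
        have h0 : lorentz (B v (x - γ • v)) (B v (x - γ • v)) = 0 := by
          simp only [map_sub, map_smul, LinearMap.sub_apply, LinearMap.smul_apply, map_smulₛₗ,
            smul_eq_mul]
          linear_combination this / 4
        rw [h0, Complex.zero_re]
      · rw [map_sub, map_smul, Pi.sub_apply, Pi.smul_apply, smul_eq_mul]
        field_simp
        ring
    obtain ⟨x, hxv, hxx⟩ : ∃ x, lorentz x v = 0 ∧ (lorentz x x).re < 0 ∧ B v x = 0 := by
      obtain ⟨x, hx, hxneg⟩ := exists_neg_orthogonal v
      obtain ⟨γ, hγ⟩ := hred x hx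
      refine ⟨x - γ • v, by simp [hx, hv], ?_, hγ⟩
      simpa [hx, hv, lorentz_eq_zero_symm hx] using hxneg
    obtain ⟨hxx, hBx⟩ := hxx
    have hvx := lorentz_eq_zero_symm hxv
    have hxx0 : lorentz x x ≠ 0 := fun h => by simp [h] at hxx
    have hAvx : A v x = 0 := by
      have := hQ.pol v x x x
      rw [hBx, map_zero, LinearMap.zero_apply, hvx] at this
      have h2 : lorentz x x * A v x = 0 := by linear_combination -this / 2
      exact (mul_eq_zero.1 h2).resolve_left hxx0
    obtain ⟨μ, hμ⟩ : ∃ μ : ℝ, μ = -(A x x).re / (lorentz x x).re := ⟨_, rfl⟩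
    have hμx : A x x = -(μ * lorentz x x) := by
      have := hxx.ne
      have h2 : (A x x).re = -(μ * (lorentz x x).re) := by rw [hμ]; field_simp
      rw [← ofReal_lorentz_self_re, ← ofReal_re_of_hermitian hQ.herm, h2]
      push_cast
      rfl
    have hAv : ∀ c, A v c = μ * lorentz v c := by
      intro c
      have := hQ.pol v x c x
      rw [hBx, map_zero, LinearMap.zero_apply, hvx, hAvx, hμx] at this
      have h2 : lorentz x x * (A v c - μ * lorentz v c) = 0 := by linear_combination -this
      exact sub_eq_zero.1 ((mul_eq_zero.1 h2).resolve_left hxx0)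
    rcases lt_trichotomy μ 0 with hμ0 | hμ0 | hμ0
    · refine hb (eq_zero_of_orthogonal_of_pos (a := B x x) ?_ ?_ (by simp [hvv]))
      · rw [hQ.sq, hxv, zero_mul]
      · rw [hQ.sq, hμx, ← ofReal_lorentz_self_re]
        have : (((lorentz x x).re : ℝ) : ℂ) * -(μ * ((lorentz x x).re : ℝ)) =
            ((-μ * (lorentz x x).re ^ 2 : ℝ) : ℂ) := by push_cast; ring
        rw [this, Complex.ofReal_re]
        have h3 : 0 < -μ := by linarith
        have h4 : 0 < (lorentz x x).re ^ 2 := sq_pos_of_neg hxx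
        positivity
    · have hAv0 : ∀ c, A v c = 0 := fun c => by rw [hAv, hμ0]; simp
      refine hQ.nondegenerate hI hl0 fun y hy z => ?_
      obtain ⟨γ, hγ⟩ := hred y (by simpa using hy)
      have := hker hAv0 _ hγ z
      simpa [hAv0] using this
    · refine hb (eq_zero_of_orthogonal_of_pos (a := B v w) ?_ ?_ (by simp [hvv]))
      · have := hQ.pol v w v v
        rw [hv, hA0] at this
        linear_combination this / 4
      · have h1 := hQ.pol v w v w
        have h2 : A w v = μ * conj (lorentz v w) := by
          rw [← hQ.herm, hAv, map_mul, Complex.conj_ofReal]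
        rw [hv, hA0, hAv w, h2, ← conj_lorentz v w] at h1
        have h3 : lorentz (B v w) (B v w) = ((μ * ‖lorentz v w‖ ^ 2 / 2 : ℝ) : ℂ) := by
          push_cast
          rw [← Complex.mul_conj']
          linear_combination h1 / 4
        rw [h3, Complex.ofReal_re]
        positivity

theorem IsQuotient.pos_of_null [Nontrivial σ] (hQ : IsQuotient B A) (hI : IsIrred B)
    {v : Option σ → ℂ} (hv : lorentz v v = 0) (hv0 : v ≠ 0) : 0 < (A v v).re := by
  refine lt_of_le_of_ne (hQ.nonneg_of_null hv hv0) fun h => ?_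
  refine hQ.ne_zero_of_null hI hv hv0 ?_
  rw [← ofReal_re_of_hermitian hQ.herm, ← h, Complex.ofReal_zero]

end Positivity

/-! ### Homogenization of rational maps of degree two. -/

section Polynomials

variable {σ ι : Type}

theorem exists_linear_of_degree_le_one (m : σ →₀ ℕ) (hm : m.degree ≤ 1) :
    ∃ φ : (Option σ → ℂ) →ₗ[ℂ] ℂ, ∀ z : EuclideanSpace ℂ σ,
      φ (homogCoord z) = m.prod fun i k => z i ^ k := by
  classical
  by_cases h0 : m = 0
  · exact ⟨LinearMap.proj none, fun z => by simp [h0]⟩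
  obtain ⟨i, hi⟩ := Finsupp.support_nonempty_iff.2 h0
  have hle : Finsupp.single i 1 ≤ m := by
    simpa [Nat.one_le_iff_ne_zero] using hi
  obtain ⟨m', rfl⟩ := exists_add_of_le hle
  have : m' = 0 := by
    rw [map_add, Finsupp.degree_single] at hm
    rw [← Finsupp.degree_eq_zero_iff]; omega
  exact ⟨LinearMap.proj (some i), fun z => by simp [this]⟩

theorem exists_bilinear_of_degree_le_two (m : σ →₀ ℕ) (hm : m.degree ≤ 2) :
    ∃ b : (Option σ → ℂ) →ₗ[ℂ] (Option σ → ℂ) →ₗ[ℂ] ℂ, (∀ x y, b x y = b y x) ∧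
      ∀ z : EuclideanSpace ℂ σ, b (homogCoord z) (homogCoord z) = m.prod fun i k => z i ^ k := by
  classical
  have key : ∀ φ ψ : (Option σ → ℂ) →ₗ[ℂ] ℂ,
      ∃ b : (Option σ → ℂ) →ₗ[ℂ] (Option σ → ℂ) →ₗ[ℂ] ℂ, (∀ x y, b x y = b y x) ∧
        ∀ x, b x x = φ x * ψ x := by
    intro φ ψ
    refine ⟨LinearMap.mk₂ ℂ (fun x y => (φ x * ψ y + φ y * ψ x) / 2) ?_ ?_ ?_ ?_, ?_, ?_⟩
    · intro x x' y; simp only [map_add]; ring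
    · intro c x y; simp only [map_smul, smul_eq_mul]; ring
    · intro x y y'; simp only [map_add]; ring
    · intro c x y; simp only [map_smul, smul_eq_mul]; ring
    · intro x y; simp only [LinearMap.mk₂_apply]; ring
    · intro x; simp only [LinearMap.mk₂_apply]; ring
  by_cases h0 : m = 0
  · obtain ⟨b, hb, hbx⟩ := key (LinearMap.proj none) (LinearMap.proj none)
    exact ⟨b, hb, fun z => by simp [hbx, h0]⟩
  obtain ⟨i, hi⟩ := Finsupp.support_nonempty_iff.2 h0
  have hle : Finsupp.single i 1 ≤ m := by
    simpa [Nat.one_le_iff_ne_zero] using hi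
  obtain ⟨m', rfl⟩ := exists_add_of_le hle
  obtain ⟨φ, hφ⟩ := exists_linear_of_degree_le_one m' (by
    rw [map_add, Finsupp.degree_single] at hm; omega)
  obtain ⟨b, hb, hbx⟩ := key (LinearMap.proj (some i)) φ
  refine ⟨b, hb, fun z => ?_⟩
  rw [hbx, hφ, Finsupp.prod_add_index' (by simp) (by simp [pow_add])]
  simp

theorem exists_bilinear_of_totalDegree_le_two (p : MvPolynomial σ ℂ) (hp : p.totalDegree ≤ 2) :
    ∃ b : (Option σ → ℂ) →ₗ[ℂ] (Option σ → ℂ) →ₗ[ℂ] ℂ, (∀ x y, b x y = b y x) ∧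
      ∀ z : EuclideanSpace ℂ σ,
        b (homogCoord z) (homogCoord z) = MvPolynomial.eval (fun j => z j) p := by
  have h : ∀ m : p.support, ∃ b : (Option σ → ℂ) →ₗ[ℂ] (Option σ → ℂ) →ₗ[ℂ] ℂ,
      (∀ x y, b x y = b y x) ∧ ∀ z : EuclideanSpace ℂ σ,
        b (homogCoord z) (homogCoord z) = m.1.prod fun i k => z i ^ k := fun m =>
    exists_bilinear_of_degree_le_two m.1 ((MvPolynomial.le_totalDegree m.2).trans hp)
  choose b hb hbz using h
  refine ⟨∑ m : p.support, p.coeff m.1 • b m, fun x y => ?_, fun z => ?_⟩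
  · simp only [LinearMap.sum_apply, LinearMap.smul_apply, hb _ x y]
  · rw [MvPolynomial.eval_eq]
    simp only [LinearMap.sum_apply, LinearMap.smul_apply, hbz, smul_eq_mul]
    exact Finset.sum_coe_sort p.support (fun m => p.coeff m * m.prod fun i k => z i ^ k)

variable [Fintype σ]

theorem exists_polynomial_of_linear (φ : (Option σ → ℂ) →ₗ[ℂ] ℂ) :
    ∃ p : MvPolynomial σ ℂ, p.totalDegree ≤ 1 ∧ ∀ z : σ → ℂ,
      MvPolynomial.eval z p = φ (homogCoord (WithLp.toLp 2 z)) := by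
  classical
  refine ⟨MvPolynomial.C (φ (Pi.single none 1)) +
    ∑ j, MvPolynomial.C (φ (Pi.single (some j) 1)) * MvPolynomial.X j, ?_, fun z => ?_⟩
  · refine (MvPolynomial.totalDegree_add _ _).trans (max_le (by simp) ?_)
    refine MvPolynomial.totalDegree_finsetSum_le fun j _ => ?_
    exact (MvPolynomial.totalDegree_mul _ _).trans (by simp)
  · rw [LinearMap.pi_apply_eq_sum_univ φ (homogCoord _), Fintype.sum_option]
    have hs : ∀ o : Option σ, (fun j => if o = j then (1 : ℂ) else 0) = Pi.single o 1 := by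
      intro o; funext j; simp [Pi.single_apply, eq_comm]
    simp [hs, mul_comm]

variable [Fintype ι]

/-- Both parts of irreducibility come from lowest terms. A linear factor dehomogenizes to a common
divisor, which must be constant, and then all degrees drop to at most 1; this includes the
hyperplane at infinity. If all components are multiples of the denominator, it is a unit and the map
is constant. The factor `c` may still be zero here, because the denominator might vanish on the
sphere. -/
theorem exists_quadratic_lift {f : USphere σ → USphere ι} (hf : IsRationalOfDegree f 2) :
    ∃ B : (Option σ → ℂ) →ₗ[ℂ] (Option σ → ℂ) →ₗ[ℂ] (Option ι → ℂ),
      (∀ x y, B x y = B y x) ∧ IsIrred B ∧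
      ∀ z : USphere σ, ∃ c : ℂ,
        B (homogCoord z.1) (homogCoord z.1) = c • homogCoord (f z).1 := by
  obtain ⟨p, q, -, hgcd, hpq, hdeg⟩ := hf
  let P : Option ι → MvPolynomial σ ℂ := fun o => o.elim q p
  have hdvd : ∀ r : MvPolynomial σ ℂ, (∀ o, r ∣ P o) → IsUnit r := fun r hr =>
    hgcd r (hr none) fun i => hr (some i)
  have hP2 : ∀ o, (P o).totalDegree ≤ 2 := by
    intro o
    rw [← hdeg]
    cases o with
    | none => exact le_max_right _ _
    | some i => exact (Finset.le_sup (f := fun i => (p i).totalDegree)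
        (Finset.mem_univ i)).trans (le_max_left _ _)
  have hP1 : ¬ ∀ o, (P o).totalDegree ≤ 1 := by
    intro h
    have : max (Finset.univ.sup fun i => (p i).totalDegree) q.totalDegree ≤ 1 :=
      max_le (Finset.sup_le fun i _ => h (some i)) (h none)
    omega
  choose b hb hbz using fun o => exists_bilinear_of_totalDegree_le_two (P o) (hP2 o)
  let B : (Option σ → ℂ) →ₗ[ℂ] (Option σ → ℂ) →ₗ[ℂ] (Option ι → ℂ) :=
    LinearMap.mk₂ ℂ (fun x y o => b o x y)
      (fun x x' y => by funext o; simp) (fun c x y => by funext o; simp)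
      (fun x y y' => by funext o; simp) (fun c x y => by funext o; simp)
  have hBz : ∀ (z : EuclideanSpace ℂ σ) o, B (homogCoord z) (homogCoord z) o =
      MvPolynomial.eval (fun j => z j) (P o) := fun z o => hbz o z
  have hBs : ∀ x y, B x y = B y x := fun x y => funext fun o => hb o x y
  have hunit : ∀ r : MvPolynomial σ ℂ, IsUnit r → r.totalDegree = 0 := by
    intro r hr
    obtain ⟨c, -, rfl⟩ := MvPolynomial.isUnit_iff_eq_C_of_isReduced.1 hr
    simp
  refine ⟨B, hBs, ⟨fun l hl => ?_, fun e φ he h => ?_⟩, fun z => ⟨MvPolynomial.eval (fun j => z.1 j) q, ?_⟩⟩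
  · by_contra! hker
    obtain ⟨e, he⟩ : ∃ e, l e = 1 := by
      obtain ⟨w, hw⟩ : ∃ w, l w ≠ 0 := by
        by_contra! h'
        exact hl (LinearMap.ext h')
      exact ⟨(l w)⁻¹ • w, by simp [hw]⟩
    -- With l e = 1, expanding B (x - l x • e) (x - l x • e) = 0 gives B x x = l x • (2 B e x - l x
    -- • B e e).
    let m : (Option σ → ℂ) →ₗ[ℂ] (Option ι → ℂ) := (2 : ℂ) • B e - l.smulRight (B e e)
    have hm : ∀ x, B x x = l x • m x := by
      intro x
      have h1 := hker (x - l x • e) (by simp [he])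
      simp only [map_sub, map_smul, LinearMap.sub_apply, LinearMap.smul_apply, hBs x e] at h1
      rw [← sub_eq_zero, ← h1]
      simp only [m, LinearMap.sub_apply, LinearMap.smul_apply, LinearMap.smulRight_apply]
      module
    obtain ⟨r, hr, hrz⟩ := exists_polynomial_of_linear l
    choose s hs hsz using fun o => exists_polynomial_of_linear (LinearMap.proj o ∘ₗ m)
    have hfac : ∀ o, P o = r * s o := by
      intro o
      refine MvPolynomial.funext fun z => ?_
      rw [map_mul, hrz, hsz]
      have := hBz (WithLp.toLp 2 z) o
      rw [hm] at this
      exact this.symm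
    have hr0 := hunit r (hdvd r fun o => ⟨s o, hfac o⟩)
    refine hP1 fun o => ?_
    rw [hfac]
    exact (MvPolynomial.totalDegree_mul _ _).trans (by simpa [hr0] using hs o)
  · have hfac : ∀ o, P o = MvPolynomial.C (e o / e none) * q := by
      intro o
      refine MvPolynomial.funext fun z => ?_
      have h1 := hBz (WithLp.toLp 2 z) o
      have h2 := hBz (WithLp.toLp 2 z) none
      rw [h] at h1 h2
      simp only [Pi.smul_apply, smul_eq_mul] at h1 h2
      rw [map_mul, MvPolynomial.eval_C]
      change _ = _ * MvPolynomial.eval z (P none)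
      rw [← h1, ← h2]
      field_simp
    have hq0 := hunit q (hdvd q fun o => ⟨_, (hfac o).trans (mul_comm _ _)⟩)
    refine hP1 fun o => ?_
    rw [hfac]
    exact (MvPolynomial.totalDegree_mul _ _).trans (by simp [hq0])
  · funext o
    rw [hBz]
    cases o with
    | none => simp [P]
    | some i => simpa [P] using (hpq z i).symm

end Polynomials

/-! ### A timelike eigenvector by minimization over the ball. -/

section Eigenvector

variable {σ : Type}

theorem continuous_homogCoord : Continuous (homogCoord (ι := σ)) := by
  refine continuous_pi fun o => ?_
  cases o with
  | none => exact continuous_const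
  | some i => simp only [homogCoord_some]; fun_prop

variable [Fintype σ] {A : (Option σ → ℂ) →ₗ[ℂ] (Option σ → ℂ) →ₗ⋆[ℂ] ℂ}

theorem continuous_form_self (hA : ∀ x y, conj (A x y) = A y x) :
    Continuous fun x => A x x := by
  classical
  have h : ∀ x, A x x = ∑ o, x o * conj (A x (Pi.single o 1)) := by
    intro x
    have := LinearMap.pi_apply_eq_sum_univ (A.flip x) x
    have hs : ∀ o : Option σ, (fun j => if o = j then (1 : ℂ) else 0) = Pi.single o 1 := by
      intro o; funext j; simp [Pi.single_apply, eq_comm]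
    simpa [hs, hA] using this
  simp only [h]
  refine continuous_finsetSum _ fun o _ => (continuous_apply o).mul ?_
  exact Complex.continuous_conj.comp
    (LinearMap.continuous_of_finiteDimensional (A.flip (Pi.single o 1)))

/-- A Hermitian form which is nonnegative on the timelike vectors and vanishes at one of them has
this vector in its radical. -/
theorem eq_zero_of_timelike_minimum (hA : ∀ x y, conj (A x y) = A y x)
    (h : ∀ x, 0 < (lorentz x x).re → 0 ≤ (A x x).re) {u : Option σ → ℂ}
    (hu : 0 < (lorentz u u).re) (hu0 : A u u = 0) (y : Option σ → ℂ) : A u y = 0 := by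
  -- For large t the vector y + t u is timelike, and A at it is 2 t Re A(u, y) + A(y, y); a negative
  -- real part would make this negative. Applying the bound to -y and i y removes real and imaginary
  -- parts.
  have key : ∀ y, 0 ≤ (A u y).re := by
    intro y
    by_contra! hneg
    obtain ⟨t₀, ht₀⟩ := exists_quadratic_pos hu (lorentz y u + lorentz u y).re (lorentz y y).re
    set t := max t₀ ((A y y).re + 1) ⊔ (((A y y).re + 1) / (-2 * (A u y).re)) with ht
    have h1 : t₀ ≤ t := (le_max_left _ _).trans (le_max_left _ _)
    have h2 : ((A y y).re + 1) / (-2 * (A u y).re) ≤ t := le_max_right _ _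
    have e1 : lorentz (y + (t : ℂ) • u) (y + (t : ℂ) • u) =
        lorentz u u * ((t ^ 2 : ℝ) : ℂ) + (lorentz y u + lorentz u y) * (t : ℂ)
          + lorentz y y := by
      simp only [map_add, map_smul, LinearMap.add_apply, LinearMap.smul_apply, map_smulₛₗ,
        smul_eq_mul, Complex.conj_ofReal]
      push_cast
      ring
    have e2 : A (y + (t : ℂ) • u) (y + (t : ℂ) • u) =
        (A u y + conj (A u y)) * (t : ℂ) + A y y := by
      rw [hA]
      simp only [map_add, map_smul, LinearMap.add_apply, LinearMap.smul_apply, map_smulₛₗ,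
        smul_eq_mul, Complex.conj_ofReal, hu0]
      ring
    have h3 := h (y + (t : ℂ) • u) (by
      rw [e1, Complex.add_re, Complex.add_re, Complex.re_mul_ofReal, Complex.re_mul_ofReal]
      linarith [ht₀ t h1])
    rw [e2, Complex.add_re, Complex.re_mul_ofReal, Complex.add_re, Complex.conj_re] at h3
    rw [div_le_iff₀ (by linarith)] at h2
    linarith
  have hre : ∀ y, (A u y).re = 0 := fun y => le_antisymm (by
    have := key (-y)
    simp only [map_neg, Complex.neg_re] at this
    linarith) (key y)
  refine Complex.ext (hre y) ?_
  have := hre (Complex.I • y)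
  rw [map_smulₛₗ, Complex.conj_I] at this
  simpa using this

theorem exists_timelike_eigenvector (hA : ∀ x y, conj (A x y) = A y x)
    (hpos : ∀ v, lorentz v v = 0 → v ≠ 0 → 0 < (A v v).re) :
    ∃ (u : Option σ → ℂ) (μ : ℝ), lorentz u u = 1 ∧ ∀ y, A u y = μ * lorentz u y := by
  set a : EuclideanSpace ℂ σ → ℝ := fun z => (A (homogCoord z) (homogCoord z)).re with ha
  have hac : Continuous a :=
    Complex.continuous_re.comp ((continuous_form_self hA).comp continuous_homogCoord)
  -- A sublevel set of the ratio a z / (1 - ‖z‖²), written without division. Positivity of `A` on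
  -- null vectors keeps it away from the boundary sphere, so it is compact inside the open ball.
  set K : Set (EuclideanSpace ℂ σ) :=
    Metric.closedBall 0 1 ∩ {z | a z ≤ a 0 * (1 - ‖z‖ ^ 2)} with hK
  have hKc : IsCompact K := (isCompact_closedBall _ _).inter_right
    (isClosed_le hac (by fun_prop))
  have hK0 : (0 : EuclideanSpace ℂ σ) ∈ K := by simp [hK]
  have hKlt : ∀ z ∈ K, 0 < 1 - ‖z‖ ^ 2 := by
    rintro z ⟨hz1, hz2⟩
    rw [mem_closedBall_zero_iff] at hz1
    rcases hz1.lt_or_eq with h | h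
    · nlinarith [norm_nonneg z]
    · have := hpos (homogCoord z) (by rw [lorentz_homogCoord_self, h]; simp) (homogCoord_ne_zero z)
      simp only [Set.mem_ofPred_eq, h] at hz2
      simp only [ha] at hz2
      norm_num at hz2
      linarith
  obtain ⟨z₀, hz₀, hmin⟩ := hKc.exists_isMinOn ⟨0, hK0⟩
    (f := fun z => a z / (1 - ‖z‖ ^ 2))
    (ContinuousOn.div hac.continuousOn (by fun_prop) fun z hz => (hKlt z hz).ne')
  set μ := a z₀ / (1 - ‖z₀‖ ^ 2) with hμ
  have hle : ∀ z : EuclideanSpace ℂ σ, 0 < 1 - ‖z‖ ^ 2 → μ * (1 - ‖z‖ ^ 2) ≤ a z := by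
    intro z hz
    by_cases hzK : z ∈ K
    · have := hmin hzK
      simp only [Set.mem_ofPred_eq] at this
      rwa [← hμ, le_div_iff₀ hz] at this
    · have h0 := hmin hK0
      simp only [Set.mem_ofPred_eq, norm_zero] at h0
      rw [← hμ] at h0
      norm_num at h0
      have h1 : a 0 * (1 - ‖z‖ ^ 2) < a z := by
        by_contra! h
        refine hzK ⟨?_, h⟩
        rw [mem_closedBall_zero_iff]
        nlinarith [norm_nonneg z]
      nlinarith
  -- Minimality says that A - μ ⟨·, ·⟩ is nonnegative on timelike vectors and zero at the minimizer,
  -- which therefore lies in its radical; this is the eigenvector equation.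
  set C : (Option σ → ℂ) →ₗ[ℂ] (Option σ → ℂ) →ₗ⋆[ℂ] ℂ := A - (μ : ℂ) • lorentz with hC
  have hCa : ∀ x y, C x y = A x y - μ * lorentz x y := fun x y => by simp [hC]
  have hCz : ∀ z : EuclideanSpace ℂ σ, (C (homogCoord z) (homogCoord z)).re =
      a z - μ * (1 - ‖z‖ ^ 2) := by
    intro z
    rw [hCa, lorentz_homogCoord_self, ← Complex.ofReal_mul, Complex.sub_re, Complex.ofReal_re]
  have hCh : ∀ x y, conj (C x y) = C y x := by
    intro x y
    rw [hCa, hCa, map_sub, map_mul, hA, conj_lorentz, Complex.conj_ofReal]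
  have hz₀pos := hKlt z₀ hz₀
  have hCpos : ∀ x, 0 < (lorentz x x).re → 0 ≤ (C x x).re := by
    intro x hx
    have hx0 : x none ≠ 0 := fun h0 => by
      have := eq_zero_of_none_eq_zero hx.le h0
      simp [this] at hx
    obtain ⟨z, hz⟩ := exists_lift_of_none_ne_zero hx0
    have hsc : ∀ D : (Option σ → ℂ) →ₗ[ℂ] (Option σ → ℂ) →ₗ⋆[ℂ] ℂ,
        (D x x).re = ‖x none‖ ^ 2 * (D (homogCoord z) (homogCoord z)).re := by
      intro D
      have : D x x = ((‖x none‖ ^ 2 : ℝ) : ℂ) * D (homogCoord z) (homogCoord z) := by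
        conv_lhs => rw [hz]
        simp only [map_smul, LinearMap.smul_apply, map_smulₛₗ, smul_eq_mul]
        push_cast
        rw [← Complex.mul_conj']
        ring
      rw [this, Complex.re_ofReal_mul]
    have hn : 0 < ‖x none‖ ^ 2 := by positivity
    rw [hsc, lorentz_homogCoord_self, Complex.ofReal_re] at hx
    rw [hsc, hCz]
    have := hle z (pos_of_mul_pos_right hx hn.le)
    exact mul_nonneg hn.le (by linarith)
  have hu0 : 0 < (lorentz (homogCoord z₀) (homogCoord z₀)).re := by
    rw [lorentz_homogCoord_self, Complex.ofReal_re]; exact hz₀pos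
  have hrad := eq_zero_of_timelike_minimum hCh hCpos hu0 (by
    rw [← ofReal_re_of_hermitian hCh, hCz, hμ, div_mul_cancel₀ _ hz₀pos.ne', sub_self,
      Complex.ofReal_zero])
  set r : ℝ := √(1 - ‖z₀‖ ^ 2) with hr
  have hr0 : (r : ℂ) ≠ 0 := by
    rw [Complex.ofReal_ne_zero]; exact (Real.sqrt_pos.2 hz₀pos).ne'
  have hr2 : (r : ℂ) * r = lorentz (homogCoord z₀) (homogCoord z₀) := by
    rw [lorentz_homogCoord_self, ← Complex.ofReal_mul, hr, Real.mul_self_sqrt hz₀pos.le]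
  refine ⟨(r : ℂ)⁻¹ • homogCoord z₀, μ, ?_, fun y => ?_⟩
  · simp only [map_smul, LinearMap.smul_apply, map_smulₛₗ, smul_eq_mul, map_inv₀,
      Complex.conj_ofReal, ← hr2]
    field_simp
  · have := hrad y
    rw [hCa] at this
    simp only [map_smul, LinearMap.smul_apply, smul_eq_mul]
    linear_combination (r : ℂ)⁻¹ * this

end Eigenvector

/-! ### Simultaneous diagonalization from a timelike eigenvector. -/

section Diagonalization

variable {n : ℕ} {A : (Option (Fin n) → ℂ) →ₗ[ℂ] (Option (Fin n) → ℂ) →ₗ⋆[ℂ] ℂ}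

/-- The vector of homogeneous coordinates with vanishing first coordinate. -/
noncomputable def spaceVec {ι : Type} : EuclideanSpace ℂ ι →ₗ[ℂ] (Option ι → ℂ) where
  toFun y o := o.elim 0 fun i => y i
  map_add' x y := by funext o; cases o <;> simp
  map_smul' c x := by funext o; cases o <;> simp

@[simp] theorem spaceVec_none {ι : Type} (y : EuclideanSpace ℂ ι) : spaceVec y none = 0 := rfl
@[simp] theorem spaceVec_some {ι : Type} (y : EuclideanSpace ℂ ι) (i : ι) :
    spaceVec y (some i) = y i := rfl

theorem eq_timeVec_add_spaceVec {ι : Type} (x : Option ι → ℂ) :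
    x = x none • timeVec ι + spaceVec (spacePart x) := by
  funext o; cases o <;> simp [spacePart]

/-- A Hermitian form with a timelike eigenvector relative to the Lorentz form can be diagonalized
by an isometry of the Lorentz form. -/
theorem exists_diagonalization (hA : ∀ x y, conj (A x y) = A y x) {u : Option (Fin n) → ℂ} {μ : ℝ}
    (hu : lorentz u u = 1) (hAu : ∀ y, A u y = μ * lorentz u y) :
    ∃ (M : (Option (Fin n) → ℂ) ≃ₗ[ℂ] (Option (Fin n) → ℂ)) (ev : Fin n → ℝ), Antitone ev ∧
      (∀ x y, lorentz (M x) (M y) = lorentz x y) ∧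
      ∀ x y, A (M x) (M y) =
        μ * (x none * conj (y none)) + ∑ j, ev j * (x (some j) * conj (y (some j))) := by
  classical
  obtain ⟨S, hS, hSu⟩ := exists_isometry_timeVec hu
  set C := pullbackForm A S.toLinearMap with hC
  have hCa : ∀ x y, C x y = A (S x) (S y) := fun x y => rfl
  have hCh : ∀ x y, conj (C x y) = C y x := fun x y => hA _ _
  have hCe : ∀ y, C (timeVec (Fin n)) y = μ * conj (y none) := fun y => by
    rw [hCa, hSu, hAu, ← hSu, hS, lorentz_timeVec_left]
  have hCe' : ∀ y, C y (timeVec (Fin n)) = μ * y none := fun y => by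
    rw [← hCh, hCe, map_mul, Complex.conj_conj, Complex.conj_ofReal]
  -- With the eigenvector moved to `timeVec`, the form splits off the time direction. On the space
  -- part the Lorentz form is minus the Euclidean product, so the spectral theorem for the operator
  -- of the remaining block finishes.
  let T : EuclideanSpace ℂ (Fin n) →ₗ[ℂ] EuclideanSpace ℂ (Fin n) :=
    { toFun := fun y => WithLp.toLp 2 fun j => C (spaceVec y) (Pi.single (some j) 1)
      map_add' := fun x y => by ext j; simp
      map_smul' := fun c x => by ext j; simp }
  have hT : ∀ x y, inner ℂ x (T y) = C (spaceVec y) (spaceVec x) := by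
    intro x y
    have h := LinearMap.pi_apply_eq_sum_univ (C.flip (spaceVec y)) (spaceVec x)
    rw [← hCh, ← LinearMap.flip_apply, LinearMap.flip_apply]
    have hs : ∀ o : Option (Fin n), (fun j => if o = j then (1 : ℂ) else 0) = Pi.single o 1 := by
      intro o; funext j; simp [Pi.single_apply, eq_comm]
    simp only [hs, LinearMap.flip_apply, Fintype.sum_option, spaceVec_none,
      spaceVec_some, smul_eq_mul, zero_mul, zero_add] at h
    rw [h, map_sum, PiLp.inner_apply]
    refine Finset.sum_congr rfl fun j _ => ?_
    rw [map_mul, hCh]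
    simp [T, mul_comm]
  have hsym : T.IsSymmetric := by
    intro x y
    rw [hT, ← inner_conj_symm, hT, hCh]
  have hfin : Module.finrank ℂ (EuclideanSpace ℂ (Fin n)) = n := finrank_euclideanSpace_fin
  set b := hsym.eigenvectorBasis hfin with hb
  obtain ⟨R, hR, hRn, hRs⟩ := exists_isometry_spacePart b.repr.symm
  have hcomp : ∀ x, S (R x) = x none • u + S (spaceVec (b.repr.symm (spacePart x))) := by
    intro x
    rw [eq_timeVec_add_spaceVec (R x), hRn, hRs, map_add, map_smul, hSu]
  refine ⟨R.trans S, hsym.eigenvalues hfin, hsym.eigenvalues_antitone hfin, fun x y => ?_,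
    fun x y => ?_⟩
  · change lorentz (S (R x)) (S (R y)) = _
    rw [hS, hR]
  · change C (R x) (R y) = _
    rw [eq_timeVec_add_spaceVec (R x), eq_timeVec_add_spaceVec (R y), hRn, hRn, hRs, hRs]
    simp only [map_add, map_smul, LinearMap.add_apply, LinearMap.smul_apply, map_smulₛₗ,
      smul_eq_mul, hCe, hCe', timeVec_none, spaceVec_none, map_zero, mul_zero, map_one, mul_one,
      add_zero, zero_add, ← hT]
    congr 1
    · ring
    · rw [← LinearIsometryEquiv.inner_map_map b.repr, LinearIsometryEquiv.apply_symm_apply,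
        PiLp.inner_apply]
      refine Finset.sum_congr rfl fun j _ => ?_
      rw [hb, hsym.eigenvectorBasis_apply_self_apply hfin, ← hb,
        LinearIsometryEquiv.apply_symm_apply]
      simp [spacePart]
      ring

end Diagonalization

/-! ### The normal form of the quotient and the number of components. -/

section NormalForm

variable {n : ℕ} {ι : Type} [Fintype ι]
  {B : (Option (Fin n) → ℂ) →ₗ[ℂ] (Option (Fin n) → ℂ) →ₗ[ℂ] (Option ι → ℂ)}
  {A : (Option (Fin n) → ℂ) →ₗ[ℂ] (Option (Fin n) → ℂ) →ₗ⋆[ℂ] ℂ}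

theorem sum_lt_identity_complex (a x : Fin n → ℂ) :
    ∑ j, a j * x j ^ 2 + ∑ p : {p : Fin n × Fin n // p.1 < p.2},
      (a p.1.1 + a p.1.2) * (x p.1.1 * x p.1.2) = (∑ j, a j * x j) * ∑ k, x k := by
  have h1 : ∑ p : {p : Fin n × Fin n // p.1 < p.2},
      (a p.1.1 + a p.1.2) * (x p.1.1 * x p.1.2)
      = ∑ j, ∑ k, if j < k then (a j + a k) * (x j * x k) else 0 := by
    rw [← Finset.sum_product', Finset.univ_product_univ, ← Finset.sum_filter]
    exact (Finset.sum_subtype _ (by simp)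
      (fun p : Fin n × Fin n => (a p.1 + a p.2) * (x p.1 * x p.2))).symm
  have h2 : ∀ j k : Fin n, (if j < k then (a j + a k) * (x j * x k) else 0)
      = (if j < k then a j * x j * x k else 0) + (if j < k then a k * x k * x j else 0) := by
    intro j k; split_ifs <;> ring
  rw [h1, Finset.sum_mul_sum]
  simp only [h2, Finset.sum_add_distrib]
  rw [Finset.sum_comm (f := fun j k : Fin n => if j < k then a k * x k * x j else 0)]
  have h3 : ∀ j : Fin n, a j * x j ^ 2 = ∑ k, if j = k then a j * x j * x k else 0 := by
    intro j; simp; ring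
  simp only [h3, ← Finset.sum_add_distrib]
  refine Finset.sum_congr rfl fun j _ => Finset.sum_congr rfl fun k _ => ?_
  rcases lt_trichotomy j k with h | h | h
  · simp [h, h.ne, h.not_gt]
  · simp [h]
  · simp [h, h.ne', h.not_gt]

theorem conj_mul_self_sqrt {a : ℝ} (ha : 0 ≤ a) (x y : ℂ) :
    (√a : ℂ) * x * conj ((√a : ℂ) * y) = a * (x * conj y) := by
  have : (√a : ℂ) * √a = a := by rw [← Complex.ofReal_mul, Real.mul_self_sqrt ha]
  rw [map_mul, Complex.conj_ofReal, ← this]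
  ring

/-- Put x_j = z_j · conj w_j, S = Σ x_j and Q = Σ (1 - t_j) x_j. The linear components contribute S
- Q and the quadratic ones Q S, and 1 - (S - Q) - Q S = (1 - S)(1 + Q). -/
theorem lorentz_familyVec {t : Fin n → ℝ} (ht : ∀ j, 0 ≤ t j ∧ t j ≤ 1)
    (z w : EuclideanSpace ℂ (Fin n)) :
    lorentz (homogCoord (familyVec t z)) (homogCoord (familyVec t w)) =
      lorentz (homogCoord z) (homogCoord w) * (1 + ∑ j, ((1 - t j : ℝ) : ℂ) * (z j * conj (w j))) := by
  have e1 : ∀ j, familyVec t z (Sum.inl j) * conj (familyVec t w (Sum.inl j)) =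
      t j * (z j * conj (w j)) := fun j => conj_mul_self_sqrt (ht j).1 _ _
  have e2 : ∀ j, familyVec t z (Sum.inr (Sum.inl j)) * conj (familyVec t w (Sum.inr (Sum.inl j))) =
      ((1 - t j : ℝ) : ℂ) * (z j * conj (w j)) ^ 2 := fun j =>
    (conj_mul_self_sqrt (by linarith [(ht j).2]) _ _).trans (by rw [map_pow]; ring)
  have e3 : ∀ p : {p : Fin n × Fin n // p.1 < p.2},
      familyVec t z (Sum.inr (Sum.inr p)) * conj (familyVec t w (Sum.inr (Sum.inr p))) =
      (((1 - t p.1.1 : ℝ) : ℂ) + ((1 - t p.1.2 : ℝ) : ℂ)) *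
        ((z p.1.1 * conj (w p.1.1)) * (z p.1.2 * conj (w p.1.2))) := fun p =>
    (conj_mul_self_sqrt (by linarith [(ht p.1.1).2, (ht p.1.2).2]) _ _).trans
      (by rw [map_mul]; push_cast; ring)
  rw [lorentz_homogCoord, lorentz_homogCoord, Fintype.sum_sum_type, Fintype.sum_sum_type]
  simp only [e1, e2, e3]
  rw [sum_lt_identity_complex (fun j => ((1 - t j : ℝ) : ℂ)) (fun j => z j * conj (w j))]
  have e4 : ∑ j, (t j : ℂ) * (z j * conj (w j)) =
      ∑ j, z j * conj (w j) - ∑ j, ((1 - t j : ℝ) : ℂ) * (z j * conj (w j)) := by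
    rw [← Finset.sum_sub_distrib]
    exact Finset.sum_congr rfl fun j _ => by push_cast; ring
  rw [e4]
  ring

theorem single_mul_conj_single {κ : Type} [DecidableEq κ] {o o' : κ} (h : o ≠ o') (i : κ) :
    (Pi.single o 1 : κ → ℂ) i * conj ((Pi.single o' 1 : κ → ℂ) i) = 0 := by
  by_cases hi : i = o
  · subst hi; simp [h]
  · simp [hi]

/-- The standard basis of the space of homogeneous coordinates is orthogonal. -/
theorem lorentz_single_ne {o o' : Option ι} [DecidableEq ι] (h : o ≠ o') :
    lorentz (Pi.single o 1 : Option ι → ℂ) (Pi.single o' 1) = 0 := by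
  simp [lorentz_apply, single_mul_conj_single h]

theorem lorentz_single_none [DecidableEq ι] :
    lorentz (Pi.single none 1 : Option ι → ℂ) (Pi.single none 1) = 1 := by
  simp [lorentz_apply]

theorem lorentz_single_some [DecidableEq ι] (i : ι) :
    lorentz (Pi.single (some i) 1 : Option ι → ℂ) (Pi.single (some i) 1) = -1 := by
  simp [lorentz_apply, Pi.single_apply]

/-- The signs and the number of the coefficients of a diagonalized Hermitian form. -/
theorem IsQuotient.exists_param (hn : 2 ≤ n) (hQ : IsQuotient B A) (hI : IsIrred B) :
    ∃ (M : (Option (Fin n) → ℂ) ≃ₗ[ℂ] (Option (Fin n) → ℂ)) (μ : ℝ) (t : Param n),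
      (∀ x y, lorentz (M x) (M y) = lorentz x y) ∧ 0 < μ ∧
      (∀ x y, A (M x) (M y) = μ * (x none * conj (y none) +
        ∑ j, ((1 - t.1 j : ℝ) : ℂ) * (x (some j) * conj (y (some j))))) := by
  have : Nontrivial (Fin n) := Fin.nontrivial_iff_two_le.2 hn
  obtain ⟨u, μ, hu, hAu⟩ := exists_timelike_eigenvector hQ.herm fun v => hQ.pos_of_null hI
  obtain ⟨M, ev, hev, hM, hAM⟩ := exists_diagonalization hQ.herm hu hAu
  set s : Option (Fin n) → Option (Fin n) → ℂ := fun o => Pi.single o 1 with hs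
  have hs1 : ∀ o o', o ≠ o' → lorentz (M (s o)) (M (s o')) = 0 := fun o o' h => by
    rw [hM, lorentz_single_ne h]
  have hs2 : lorentz (M (s none)) (M (s none)) = 1 := by rw [hM, lorentz_single_none]
  have hs3 : ∀ j, lorentz (M (s (some j))) (M (s (some j))) = -1 := fun j => by
    rw [hM, lorentz_single_some]
  have hA1 : ∀ o o', o ≠ o' → A (M (s o)) (M (s o')) = 0 := by
    intro o o' h
    simp [hAM, hs, single_mul_conj_single h]
  have hA2 : A (M (s none)) (M (s none)) = μ := by simp [hAM, hs]
  have hA3 : ∀ j, A (M (s (some j))) (M (s (some j))) = ev j := fun j => by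
    simp [hAM, hs, Pi.single_apply]
  -- The sum of the time vector and the j-th space vector is null, so positivity on null vectors
  -- applies.
  have hsum : ∀ j, 0 < μ + ev j := by
    intro j
    have h := hQ.pos_of_null hI (v := M (s none) + M (s (some j))) (by
      simp [hs1, hs2, hs3]) (by
      rw [← map_add, Ne, LinearEquiv.map_eq_zero_iff]
      intro h
      simpa [hs] using congrFun h none)
    simpa [hA1, hA2, hA3] using h
  have hb0 : ∀ j, lorentz (B (M (s none)) (M (s (some j)))) (B (M (s none)) (M (s (some j)))) =
      (((ev j - μ) / 4 : ℝ) : ℂ) := by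
    intro j
    have := hQ.pol (M (s none)) (M (s (some j))) (M (s none)) (M (s (some j)))
    simp only [hs1 none (some j) (by simp), hs1 (some j) none (by simp), hs2, hs3, hA2, hA3] at this
    push_cast
    linear_combination this / 4
  -- If μ ≤ 0, then ev j > -μ ≥ μ for all j, and two mutually orthogonal timelike vectors B(e, e_i),
  -- B(e, e_j) appear in the target. The next two bounds follow the same pattern, with B(e, e) as
  -- one of the vectors.
  have hμ : 0 < μ := by
    by_contra! hμ
    obtain ⟨i, j, hij⟩ := exists_pair_ne (Fin n)
    have hpos : ∀ k, 0 < (lorentz (B (M (s none)) (M (s (some k))))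
        (B (M (s none)) (M (s (some k))))).re := by
      intro k
      rw [hb0, Complex.ofReal_re]
      have := hsum k
      linarith
    have h0 := eq_zero_of_orthogonal_of_pos (by
      have := hQ.pol (M (s none)) (M (s (some i))) (M (s none)) (M (s (some j)))
      simp only [hs1 none (some j) (by simp), hs1 (some i) none (by simp),
        hs1 (some i) (some j) (by simpa using hij), hA1 (some i) (some j) (by simpa using hij)]
        at this
      linear_combination this / 4) (hpos i) (hpos j).le
    have := hpos j
    rw [h0] at this
    simp at this
  have hee : 0 < (lorentz (B (M (s none)) (M (s none))) (B (M (s none)) (M (s none)))).re := by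
    rw [hQ.sq, hs2, hA2]; simpa using hμ
  have hle : ∀ j, ev j ≤ μ := by
    intro j
    by_contra! h
    have hpos : 0 < (lorentz (B (M (s none)) (M (s (some j))))
        (B (M (s none)) (M (s (some j))))).re := by
      rw [hb0, Complex.ofReal_re]; linarith
    have h0 := eq_zero_of_orthogonal_of_pos (by
      have := hQ.pol (M (s none)) (M (s none)) (M (s none)) (M (s (some j)))
      simp only [hs1 none (some j) (by simp), hA1 none (some j) (by simp)] at this
      linear_combination this / 4) hee hpos.le
    rw [h0] at hpos
    simp at hpos
  have hnn : ∀ j, 0 ≤ ev j := by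
    intro j
    by_contra! h
    have hpos : 0 < (lorentz (B (M (s (some j))) (M (s (some j))))
        (B (M (s (some j))) (M (s (some j))))).re := by
      rw [hQ.sq, hs3, hA3]; simpa using h
    have h0 := eq_zero_of_orthogonal_of_pos (by
      rw [hQ.sq, hs1 none (some j) (by simp), zero_mul]) hee hpos.le
    rw [h0] at hpos
    simp at hpos
  refine ⟨M, μ, ⟨fun j => 1 - ev j / μ, fun i j hij => ?_, fun j => ⟨?_, ?_⟩, ?_⟩, hM, hμ,
    fun x y => ?_⟩
  · have := div_le_div_of_nonneg_right (hev hij) hμ.le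
    linarith
  · have := (div_le_one hμ).2 (hle j)
    linarith
  · have := div_nonneg (hnn j) hμ.le
    linarith
  -- All parameters equal to 1 would make `A` vanish on the hyperplane orthogonal to the
  -- eigenvector.
  · by_contra! hall
    have hev0 : ∀ j, ev j = 0 := fun j => by
      have := hall j
      field_simp at this
      linarith
    refine hQ.nondegenerate hI (l := LinearMap.proj none ∘ₗ M.symm.toLinearMap) (fun h => ?_)
      fun x hx y => ?_
    · simpa using LinearMap.congr_fun h (M (timeVec _))
    · have := hAM (M.symm x) (M.symm y)
      have hx' : M.symm x none = 0 := hx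
      simpa [hev0, hx'] using this
  · rw [hAM, mul_add, Finset.mul_sum]
    congr 1
    refine Finset.sum_congr rfl fun j _ => ?_
    have : (μ : ℂ) ≠ 0 := Complex.ofReal_ne_zero.2 hμ.ne'
    push_cast
    field_simp
    ring

/-- The coefficients of the components of the maps of the family. -/
noncomputable def familyCoeff (t : Fin n → ℝ) : FamilyIndex n → ℝ :=
  Sum.elim t (Sum.elim (fun j => 1 - t j) fun p => 2 - t p.1.1 - t p.1.2)

/-- The monomials `1`, `z_j`, `z_j²`, `z_j z_k`, `j < k`, as pairs of homogeneous coordinates. -/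
def monomialPair : Option (FamilyIndex n) → Option (Fin n) × Option (Fin n) := fun o =>
  o.elim (none, none) (Sum.elim (fun j => (none, some j))
    (Sum.elim (fun j => (some j, some j)) fun p => (some p.1.1, some p.1.2)))

theorem monomialPair_ne {o o' : Option (FamilyIndex n)} (h : o ≠ o') :
    ¬ ((monomialPair o).1 = (monomialPair o').1 ∧ (monomialPair o).2 = (monomialPair o').2) ∧
      ¬ ((monomialPair o).1 = (monomialPair o').2 ∧
        (monomialPair o).2 = (monomialPair o').1) := by
  rcases o with _ | j | j | ⟨⟨j, k⟩, hjk⟩ <;> rcases o' with _ | j' | j' | ⟨⟨j', k'⟩, hjk'⟩ <;>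
    simp [monomialPair] at h ⊢ <;> grind

/-- The number of nonzero components of a map of the family is bounded by the target dimension of
the quadratic maps with the same Hermitian form. -/
theorem IsQuotient.card_le {N : ℕ}
    {B : (Option (Fin n) → ℂ) →ₗ[ℂ] (Option (Fin n) → ℂ) →ₗ[ℂ] (Option (Fin N) → ℂ)}
    (hQ : IsQuotient B A) {M : (Option (Fin n) → ℂ) ≃ₗ[ℂ] (Option (Fin n) → ℂ)} {μ : ℝ}
    {t : Fin n → ℝ} (hM : ∀ x y, lorentz (M x) (M y) = lorentz x y) (hμ : 0 < μ)
    (hAM : ∀ x y, A (M x) (M y) = μ * (x none * conj (y none) +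
        ∑ j, ((1 - t j : ℝ) : ℂ) * (x (some j) * conj (y (some j))))) :
    Nat.card {i : FamilyIndex n // familyCoeff t i ≠ 0} ≤ N := by
  classical
  set s : Option (Fin n) → Option (Fin n) → ℂ := fun o => M (Pi.single o 1) with hs
  have hs1 : ∀ o o', o ≠ o' → lorentz (s o) (s o') = 0 := fun o o' h => by
    rw [hM, lorentz_single_ne h]
  have hs2 : lorentz (s none) (s none) = 1 := by rw [hM, lorentz_single_none]
  have hs3 : ∀ j, lorentz (s (some j)) (s (some j)) = -1 := fun j => by
    rw [hM, lorentz_single_some]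
  have hA1 : ∀ o o', o ≠ o' → A (s o) (s o') = 0 := by
    intro o o' h
    simp [hAM, hs, single_mul_conj_single h]
  have hA2 : A (s none) (s none) = μ := by simp [hAM, hs]
  have hA3 : ∀ j, A (s (some j)) (s (some j)) = μ * (1 - t j : ℝ) := fun j => by
    simp [hAM, hs, Pi.single_apply]
  -- Both forms are diagonal in the basis `s`, so a polarized term survives only if the two
  -- unordered index pairs coincide.
  have horth : ∀ a b c d, ¬ (a = c ∧ b = d) → ¬ (a = d ∧ b = c) →
      lorentz (B (s a) (s b)) (B (s c) (s d)) = 0 := by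
    intro a b c d h1 h2
    have h3 : ∀ a b c d, ¬ (a = c ∧ b = d) → lorentz (s a) (s c) * A (s b) (s d) = 0 := by
      intro a b c d h
      by_cases hac : a = c
      · rw [hA1 b d fun hbd => h ⟨hac, hbd⟩, mul_zero]
      · rw [hs1 a c hac, zero_mul]
    have := hQ.pol (s a) (s b) (s c) (s d)
    rw [h3 a b c d h1, h3 a b d c h2, h3 b a c d (by tauto), h3 b a d c (by tauto)] at this
    linear_combination this / 4
  -- One vector for each nonzero monomial and one for the constant 1. They are orthogonal and not
  -- null, hence independent in dimension N + 1; the extra vector accounts for the extra dimension.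
  let v : Option {i : FamilyIndex n // familyCoeff t i ≠ 0} → Option (Fin N) → ℂ := fun o =>
    B (s (monomialPair (o.map Subtype.val)).1) (s (monomialPair (o.map Subtype.val)).2)
  have hμ' : (μ : ℂ) ≠ 0 := Complex.ofReal_ne_zero.2 hμ.ne'
  have hne : ∀ o, lorentz (v o) (v o) ≠ 0 := by
    have hmul : ∀ (i : FamilyIndex n), familyCoeff t i ≠ 0 → (μ : ℂ) * (familyCoeff t i : ℂ) ≠ 0 :=
      fun i hi => mul_ne_zero hμ' (Complex.ofReal_ne_zero.2 hi)
    rintro (_ | ⟨j | j | ⟨⟨j, k⟩, hjk⟩, hi⟩) h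
    · change lorentz (B (s none) (s none)) (B (s none) (s none)) = 0 at h
      rw [hQ.sq, hs2, hA2, one_mul] at h
      exact hμ' h
    · change lorentz (B (s none) (s (some j))) (B (s none) (s (some j))) = 0 at h
      have h4 := hQ.pol (s none) (s (some j)) (s none) (s (some j))
      rw [h, hs2, hs3, hs1 none (some j) (by simp), hs1 (some j) none (by simp), hA2, hA3] at h4
      refine hmul _ hi ?_
      change (μ : ℂ) * (t j : ℂ) = 0
      push_cast at h4
      linear_combination h4
    · change lorentz (B (s (some j)) (s (some j))) (B (s (some j)) (s (some j))) = 0 at h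
      rw [hQ.sq, hs3, hA3] at h
      refine hmul _ hi ?_
      change (μ : ℂ) * ((1 - t j : ℝ) : ℂ) = 0
      linear_combination -h
    · change lorentz (B (s (some j)) (s (some k))) (B (s (some j)) (s (some k))) = 0 at h
      have hjk' : (some j : Option (Fin n)) ≠ some k := by simpa using hjk.ne
      have h4 := hQ.pol (s (some j)) (s (some k)) (s (some j)) (s (some k))
      rw [h, hs3, hs3, hs1 _ _ hjk', hs1 _ _ hjk'.symm, hA3, hA3] at h4
      refine hmul _ hi ?_
      change (μ : ℂ) * ((2 - t j - t k : ℝ) : ℂ) = 0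
      push_cast at h4 ⊢
      linear_combination h4
  have hvorth : ∀ o o', o ≠ o' → lorentz (v o) (v o') = 0 := by
    intro o o' h
    have := monomialPair_ne (o := o.map Subtype.val) (o' := o'.map Subtype.val)
      fun h' => h (Option.map_injective Subtype.val_injective h')
    exact horth _ _ _ _ this.1 this.2
  have hli : LinearIndependent ℂ v := by
    rw [Fintype.linearIndependent_iff]
    intro g hg o
    have h1 : lorentz (∑ o', g o' • v o') (v o) = 0 := by rw [hg]; simp
    rw [map_sum, LinearMap.sum_apply, Finset.sum_eq_single o] at h1
    · rw [map_smul, LinearMap.smul_apply, smul_eq_mul] at h1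
      exact (mul_eq_zero.1 h1).resolve_right (hne o)
    · intro o' _ ho'
      rw [map_smul, LinearMap.smul_apply, hvorth _ _ ho', smul_zero]
    · simp
  have := hli.fintype_card_le_finrank
  rw [Fintype.card_option, Module.finrank_fintype_fun_eq_card, Fintype.card_option,
    Fintype.card_fin, ← Nat.card_eq_fintype_card] at this
  omega

end NormalForm

/-! ### The equivalence relation on maps induced by Gram kernels. -/

section GramRel

variable {σ ι κ : Type} [Fintype σ] [Fintype ι] [Fintype κ]

/-- The Gram kernels of the lifts of two maps of spheres agree up to an automorphism of the source
and a rescaling of the lifts. -/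
def GramRel (f : USphere σ → USphere ι) (g : USphere σ → USphere κ) : Prop :=
  ∃ (χ : USphere σ ≃ USphere σ) (c : USphere σ → ℂ) (m : ℝ), IsSphereAut χ ∧ (∀ z, c z ≠ 0) ∧
    m ≠ 0 ∧ ∀ z w, lorentz (homogCoord (f (χ z)).1) (homogCoord (f (χ w)).1) =
      m * (c z * conj (c w)) * lorentz (homogCoord (g z).1) (homogCoord (g w).1)

theorem GramRel.symm {f : USphere σ → USphere ι} {g : USphere σ → USphere κ}
    (h : GramRel f g) : GramRel g f := by
  obtain ⟨χ, c, m, hχ, hc, hm, h⟩ := h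
  refine ⟨χ.symm, fun z => (c (χ.symm z))⁻¹, m⁻¹, hχ.symm, fun z => inv_ne_zero (hc _),
    inv_ne_zero hm, fun z w => ?_⟩
  have h1 := h (χ.symm z) (χ.symm w)
  rw [χ.apply_symm_apply, χ.apply_symm_apply] at h1
  rw [h1, map_inv₀, Complex.ofReal_inv]
  have h2 := hc (χ.symm z)
  have h3 : conj (c (χ.symm w)) ≠ 0 := (map_ne_zero _).2 (hc _)
  have h4 : (m : ℂ) ≠ 0 := Complex.ofReal_ne_zero.2 hm
  field_simp

theorem GramRel.trans {ν : Type} [Fintype ν] {f : USphere σ → USphere ι}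
    {g : USphere σ → USphere κ} {k : USphere σ → USphere ν} (h : GramRel f g)
    (h' : GramRel g k) : GramRel f k := by
  obtain ⟨χ, c, m, hχ, hc, hm, h⟩ := h
  obtain ⟨ψ, d, l, hψ, hd, hl, h'⟩ := h'
  refine ⟨ψ.trans χ, fun z => c (ψ z) * d z, m * l, hψ.trans hχ,
    fun z => mul_ne_zero (hc _) (hd _), mul_ne_zero hm hl, fun z w => ?_⟩
  have h1 := h (ψ z) (ψ w)
  rw [h'] at h1
  rw [Equiv.trans_apply, Equiv.trans_apply, h1, map_mul]
  push_cast
  ring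

/-- A target automorphism multiplies the form by a constant and each lift by a nonzero scalar, so it
disappears from the Gram kernel up to rescaling. -/
theorem SphEquivSameTarget.gramRel {f g : USphere σ → USphere ι} (h : SphEquivSameTarget f g) :
    GramRel f g := by
  obtain ⟨χ, τ, hχ, hτ, h⟩ := h
  obtain ⟨T, m, hm, hT, hTz⟩ := hτ.exists_linear
  choose c hc hTc using hTz
  refine ⟨χ, fun z => (c (g z))⁻¹, m, hχ, fun z => inv_ne_zero (hc _), hm, fun z w => ?_⟩
  have hfg : ∀ z, f (χ z) = τ (g z) := congrFun h
  have h1 := hT (homogCoord (g z).1) (homogCoord (g w).1)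
  rw [hTc, hTc, ← hfg, ← hfg] at h1
  simp only [map_smul, LinearMap.smul_apply, map_smulₛₗ, smul_eq_mul] at h1
  have h2 := hc (g z)
  have h3 : conj (c (g w)) ≠ 0 := (map_ne_zero _).2 (hc _)
  rw [map_inv₀]
  field_simp
  linear_combination h1

theorem lorentz_zeroExtend (e : ι ↪ κ) (x y : USphere ι) :
    lorentz (homogCoord (zeroExtend e x).1) (homogCoord (zeroExtend e y).1) =
      lorentz (homogCoord x.1) (homogCoord y.1) := by
  rw [lorentz_homogCoord, lorentz_homogCoord]
  congr 1
  symm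
  refine Fintype.sum_of_injective e e.injective _ _ ?_ ?_
  · intro k hk
    have : ¬ ∃ i, e i = k := fun ⟨i, hi⟩ => hk ⟨i, hi⟩
    simp [zeroExtend, Function.extend_apply' _ _ _ this]
  · intro i
    simp [zeroExtend, e.injective.extend_apply]

theorem SphericallyEquivalent.gramRel {f : USphere σ → USphere ι} {g : USphere σ → USphere κ}
    (h : SphericallyEquivalent f g) : GramRel f g := by
  rcases h with ⟨e, h⟩ | ⟨e, h⟩
  · obtain ⟨χ, c, m, hχ, hc, hm, h⟩ := h.gramRel
    exact ⟨χ, c, m, hχ, hc, hm, fun z w => by rw [← h, lorentz_zeroExtend]⟩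
  · obtain ⟨χ, c, m, hχ, hc, hm, h⟩ := h.gramRel
    exact ⟨χ, c, m, hχ, hc, hm, fun z w => by rw [h, lorentz_zeroExtend]⟩

end GramRel

/-! ### The sphere as a set of uniqueness for quadratic forms. -/

section Vanishing

variable {σ : Type} [Fintype σ]

theorem infinite_unit_circle : (Metric.sphere (0 : ℂ) 1).Infinite := by
  refine (isPreconnected_sphere (by simp) 0 1).infinite_of_nontrivial ⟨1, by simp, -1, by simp, ?_⟩
  norm_num

/-- A quadratic form vanishing at the lifts of all but finitely many points of the sphere is
zero. -/
theorem bilinear_eq_zero_of_lift [Nonempty σ] (D : (Option σ → ℂ) →ₗ[ℂ] (Option σ → ℂ) →ₗ[ℂ] ℂ)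
    {bad : Set (USphere σ)} (hbad : bad.Finite)
    (hD : ∀ z : USphere σ, z ∉ bad → D (homogCoord z.1) (homogCoord z.1) = 0)
    (x : Option σ → ℂ) : D x x = 0 := by
  classical
  have hunit : ∀ y : EuclideanSpace ℂ σ, ‖y‖ = 1 → D (timeVec σ) (timeVec σ) = 0 ∧
      D (timeVec σ) (spaceVec y) + D (spaceVec y) (timeVec σ) = 0 ∧
      D (spaceVec y) (spaceVec y) = 0 := by
    intro y hy
    have hy0 : y ≠ 0 := fun h => by simp [h] at hy
    let ζ : Metric.sphere (0 : ℂ) 1 → USphere σ := fun u => ⟨u.1 • y, by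
      rw [mem_sphere_zero_iff_norm, norm_smul, hy, mem_sphere_zero_iff_norm.1 u.2, one_mul]⟩
    have hζ : Function.Injective ζ := fun u v huv =>
      Subtype.ext (smul_left_injective ℂ hy0 (congrArg Subtype.val huv))
    -- On the circle u ↦ u y the form becomes a polynomial of degree at most 2 in u with infinitely
    -- many roots, so its three coefficients vanish separately.
    have hinf : {u : ℂ | D (timeVec σ) (timeVec σ) +
        (D (timeVec σ) (spaceVec y) + D (spaceVec y) (timeVec σ)) * u +
        D (spaceVec y) (spaceVec y) * u ^ 2 = 0}.Infinite := by
      have h1 : (ζ ⁻¹' bad)ᶜ.Infinite := by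
        have : Infinite (Metric.sphere (0 : ℂ) 1) := infinite_unit_circle.to_subtype
        exact (hbad.preimage hζ.injOn).infinite_compl
      refine (h1.image Subtype.val_injective.injOn).mono ?_
      rintro _ ⟨u, hu, rfl⟩
      have h2 := hD (ζ u) hu
      have h3 : homogCoord (ζ u).1 = timeVec σ + u.1 • spaceVec y := by
        funext o; cases o <;> simp [ζ]
      rw [h3] at h2
      simp only [map_add, map_smul, LinearMap.add_apply, LinearMap.smul_apply, smul_eq_mul] at h2
      change _ = _
      linear_combination h2
    have hp := Polynomial.eq_zero_of_infinite_isRoot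
      (Polynomial.C (D (timeVec σ) (timeVec σ)) +
        Polynomial.C (D (timeVec σ) (spaceVec y) + D (spaceVec y) (timeVec σ)) * Polynomial.X +
        Polynomial.C (D (spaceVec y) (spaceVec y)) * Polynomial.X ^ 2)
      (hinf.mono fun u hu => by
        change Polynomial.eval _ _ = _
        simpa using hu)
    refine ⟨?_, ?_, ?_⟩
    · simpa using congrArg (Polynomial.coeff · 0) hp
    · simpa [Polynomial.coeff_X] using congrArg (Polynomial.coeff · 1) hp
    · simpa [Polynomial.coeff_X] using congrArg (Polynomial.coeff · 2) hp
  obtain ⟨i⟩ := ‹Nonempty σ›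
  have hee := (hunit (EuclideanSpace.single i 1) (by simp)).1
  have hall : ∀ y : EuclideanSpace ℂ σ,
      D (timeVec σ) (spaceVec y) + D (spaceVec y) (timeVec σ) = 0 ∧
      D (spaceVec y) (spaceVec y) = 0 := by
    intro y
    by_cases hy : y = 0
    · simp [hy]
    have hy' : (‖y‖ : ℂ) ≠ 0 := by simpa using hy
    obtain ⟨-, h2, h3⟩ := hunit ((‖y‖ : ℂ)⁻¹ • y) (by
      rw [norm_smul, norm_inv, Complex.norm_real, norm_norm, inv_mul_cancel₀ (norm_ne_zero_iff.2 hy)])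
    simp only [map_smul, LinearMap.smul_apply, smul_eq_mul, ← mul_add, mul_eq_zero, inv_eq_zero,
      hy', false_or] at h2 h3
    exact ⟨h2, h3⟩
  rw [eq_timeVec_add_spaceVec x]
  obtain ⟨h2, h3⟩ := hall (spacePart x)
  simp only [map_add, map_smul, LinearMap.add_apply, LinearMap.smul_apply, smul_eq_mul, hee, h3]
  linear_combination x none * h2

/-- If the product of two linear forms vanishes at the lifts of all but finitely many points of
the sphere and the first one is nonzero, then the second one is zero. -/
theorem linear_eq_zero_of_lift [Nonempty σ] {φ ψ : (Option σ → ℂ) →ₗ[ℂ] ℂ}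
    {bad : Set (USphere σ)} (hbad : bad.Finite)
    (h : ∀ z : USphere σ, z ∉ bad → φ (homogCoord z.1) * ψ (homogCoord z.1) = 0)
    {p : Option σ → ℂ} (hp : φ p ≠ 0) (x : Option σ → ℂ) : ψ x = 0 :=
  eq_zero_of_mul_eq_zero (f := φ) (g := ψ) hp (fun c =>
    bilinear_eq_zero_of_lift (φ.smulRight ψ) hbad (fun z hz => by simpa using h z hz) c) x

end Vanishing

/-! ### The quotient form of a family map and its spectrum. -/

section ParamForm

variable {n : ℕ}

/-- The quotient of the Hermitian form of a map of the family by the Lorentz form. -/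
noncomputable def paramForm (t : Fin n → ℝ) :
    (Option (Fin n) → ℂ) →ₗ[ℂ] (Option (Fin n) → ℂ) →ₗ⋆[ℂ] ℂ :=
  LinearMap.mk₂'ₛₗ (RingHom.id ℂ) (starRingEnd ℂ)
    (fun x y => x none * conj (y none) +
      ∑ j, ((1 - t j : ℝ) : ℂ) * (x (some j) * conj (y (some j))))
    (fun x x' y => by
      simp only [Pi.add_apply, add_mul, mul_add, Finset.sum_add_distrib]; ring)
    (fun c x y => by
      simp only [Pi.smul_apply, smul_eq_mul, RingHom.id_apply, mul_add, Finset.mul_sum, mul_assoc,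
        mul_left_comm])
    (fun x y y' => by
      simp only [Pi.add_apply, map_add, mul_add, Finset.sum_add_distrib]; ring)
    (fun c x y => by
      simp only [Pi.smul_apply, smul_eq_mul, map_mul, mul_add, Finset.mul_sum, mul_left_comm])

theorem paramForm_apply (t : Fin n → ℝ) (x y : Option (Fin n) → ℂ) :
    paramForm t x y = x none * conj (y none) +
      ∑ j, ((1 - t j : ℝ) : ℂ) * (x (some j) * conj (y (some j))) := rfl

theorem conj_paramForm (t : Fin n → ℝ) (x y : Option (Fin n) → ℂ) :
    conj (paramForm t x y) = paramForm t y x := by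
  simp [paramForm_apply, mul_comm]

theorem lorentz_familyMap (t : Param n) (z w : USphere (Fin n)) :
    lorentz (homogCoord (familyMap t z).1) (homogCoord (familyMap t w).1) =
      lorentz (homogCoord z.1) (homogCoord w.1) *
        paramForm t.1 (homogCoord z.1) (homogCoord w.1) := by
  refine (lorentz_familyVec t.2.2.1 z.1 w.1).trans ?_
  simp [paramForm_apply]

@[simp] theorem paramForm_timeVec_left (t : Fin n → ℝ) (x : Option (Fin n) → ℂ) :
    paramForm t (timeVec (Fin n)) x = conj (x none) := by
  simp [paramForm_apply]

@[simp] theorem paramForm_timeVec_right (t : Fin n → ℝ) (x : Option (Fin n) → ℂ) :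
    paramForm t x (timeVec (Fin n)) = x none := by
  simp [paramForm_apply]

theorem one_le_paramForm_lift {t : Fin n → ℝ} (ht : ∀ j, 0 ≤ t j ∧ t j ≤ 1)
    (z : EuclideanSpace ℂ (Fin n)) :
    1 ≤ (paramForm t (homogCoord z) (homogCoord z)).re := by
  have : paramForm t (homogCoord z) (homogCoord z) =
      ((1 + ∑ j, (1 - t j) * ‖z j‖ ^ 2 : ℝ) : ℂ) := by
    simp [paramForm_apply, Complex.mul_conj']
  rw [this, Complex.ofReal_re]
  have : 0 ≤ ∑ j, (1 - t j) * ‖z j‖ ^ 2 :=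
    Finset.sum_nonneg fun j _ => mul_nonneg (by linarith [(ht j).2]) (by positivity)
  linarith

/-- The entries of the diagonal matrix of `paramForm t` relative to the Lorentz form. -/
noncomputable def paramEntry (t : Fin n → ℝ) : Option (Fin n) → ℂ :=
  fun o => o.elim 1 fun j => ((t j - 1 : ℝ) : ℂ)

/-- The diagonal operator which represents `paramForm t` relative to the Lorentz form. -/
noncomputable def paramOp (t : Fin n → ℝ) : (Option (Fin n) → ℂ) →ₗ[ℂ] (Option (Fin n) → ℂ) :=
  Matrix.toLin' (Matrix.diagonal (paramEntry t))

theorem lorentz_paramOp (t : Fin n → ℝ) (x y : Option (Fin n) → ℂ) :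
    lorentz (paramOp t x) y = paramForm t x y := by
  simp only [paramOp, Matrix.toLin'_apply, Matrix.mulVec_diagonal, lorentz_apply, paramForm_apply,
    paramEntry, Option.elim, one_mul, sub_eq_add_neg, ← Finset.sum_neg_distrib]
  congr 1
  refine Finset.sum_congr rfl fun j _ => ?_
  push_cast
  ring

theorem charpoly_roots_toLin'_diagonal {κ : Type} [Fintype κ] [DecidableEq κ] (d : κ → ℂ) :
    (Matrix.toLin' (Matrix.diagonal d)).charpoly.roots = Finset.univ.val.map d := by
  rw [← LinearMap.charpoly_toMatrix _ (Pi.basisFun ℂ κ), LinearMap.toMatrix_eq_toMatrix',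
    LinearMap.toMatrix'_toLin', Matrix.charpoly_diagonal, Polynomial.roots_prod _ _ (by
      simp [Finset.prod_ne_zero_iff, Polynomial.X_sub_C_ne_zero])]
  simp

theorem eq_of_monotone_of_map_eq {s t : Fin n → ℝ} (hs : Monotone s) (ht : Monotone t)
    (h : Finset.univ.val.map s = Finset.univ.val.map t) : s = t := by
  rw [Fin.univ_val_map, Fin.univ_val_map, Multiset.coe_eq_coe] at h
  exact List.ofFn_injective (h.eq_of_sortedLE hs.sortedLE_ofFn ht.sortedLE_ofFn)

/-- The parameter is determined by the conjugacy class of the diagonal operator up to a positive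
scalar. -/
theorem Param.eq_of_conj {s t : Param n} {r : ℝ} (hr : 0 < r)
    (L : (Option (Fin n) → ℂ) ≃ₗ[ℂ] (Option (Fin n) → ℂ))
    (h : ∀ x, paramOp s.1 (L x) = (r : ℂ) • L (paramOp t.1 x)) : s = t := by
  have hconj : paramOp s.1 =
      L.conj (Matrix.toLin' (Matrix.diagonal fun o => r * paramEntry t.1 o)) := by
    refine LinearMap.ext fun y => ?_
    have h1 := h (L.symm y)
    rw [L.apply_symm_apply] at h1
    rw [h1, LinearEquiv.conj_apply_apply, ← map_smul]
    congr 1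
    funext o
    simp [paramOp, Matrix.mulVec_diagonal, mul_assoc]
  have hroots : Finset.univ.val.map (paramEntry s.1) =
      Finset.univ.val.map fun o => r * paramEntry t.1 o := by
    rw [← charpoly_roots_toLin'_diagonal, ← charpoly_roots_toLin'_diagonal]
    change (paramOp s.1).charpoly.roots = _
    rw [hconj, LinearEquiv.charpoly_conj]
  -- The eigenvalue 1 of the operator for `s` is r times an entry for `t`; all entries except the
  -- time entry 1 are at most 0.
  have hr1 : r = 1 := by
    have hmem : (1 : ℂ) ∈ Finset.univ.val.map fun o => (r : ℂ) * paramEntry t.1 o := by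
      rw [← hroots]
      exact Multiset.mem_map.2 ⟨none, by simp, rfl⟩
    obtain ⟨o, -, ho⟩ := Multiset.mem_map.1 hmem
    cases o with
    | none =>
      simp only [paramEntry, Option.elim, mul_one] at ho
      exact_mod_cast ho
    | some j =>
      simp only [paramEntry, Option.elim] at ho
      have ho' : r * (t.1 j - 1) = 1 := by exact_mod_cast ho
      have := mul_nonpos_of_nonneg_of_nonpos hr.le (by linarith [(t.2.2.1 j).2] : t.1 j - 1 ≤ 0)
      linarith
  refine Subtype.ext (eq_of_monotone_of_map_eq s.2.1 t.2.1 ?_)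
  have h2 : ∀ u : Fin n → ℝ, (Finset.univ : Finset (Option (Fin n))).val.map (paramEntry u) =
      1 ::ₘ (Finset.univ.val.map u).map fun a => ((a - 1 : ℝ) : ℂ) := by
    intro u
    rw [univ_option]
    simp [Finset.insertNone, paramEntry, Function.comp_def]
  simp only [hr1, Complex.ofReal_one, one_mul] at hroots
  change _ = Finset.univ.val.map (paramEntry t.1) at hroots
  rw [h2, h2, Multiset.cons_inj_right] at hroots
  refine Multiset.map_injective (fun a b hab => ?_) hroots
  have : a - 1 = b - 1 := by exact_mod_cast hab
  linarith

end ParamForm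

/-! ### Distinct parameters have inequivalent Gram kernels. -/

section Uniqueness

variable {n : ℕ}

/-- The relation forces `a₁` to vanish on the kernel of `b₁` outside the kernel of `b₂`; translating
by `q` covers the rest, so `a₁` is a multiple of `b₁`. -/
theorem linear_eq_smul_of_cross {V : Type} [AddCommGroup V] [Module ℂ V]
    {a₁ a₂ b₁ b₂ : V →ₗ[ℂ] ℂ} {α β : ℂ} (hα : α ≠ 0)
    (h : ∀ x, α * a₁ x * b₂ x = β * a₂ x * b₁ x) {p q : V} (hp : b₁ p = 1) (hq : b₁ q = 0)
    (hq' : b₂ q ≠ 0) (x : V) : a₁ x = a₁ p * b₁ x := by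
  have key : ∀ y, b₁ y = 0 → b₂ y ≠ 0 → a₁ y = 0 := by
    intro y h1 h2
    have := h y
    rw [h1, mul_zero] at this
    exact (mul_eq_zero.1 ((mul_eq_zero.1 this).resolve_right h2)).resolve_left hα
  have hker : ∀ y, b₁ y = 0 → a₁ y = 0 := by
    intro y h1
    by_cases h2 : b₂ y = 0
    · have h3 := key (y + q) (by simp [h1, hq]) (by simpa [h2] using hq')
      rwa [map_add, key q hq hq', add_zero] at h3
    · exact key y h1 h2
  have := hker (x - b₁ x • p) (by simp [hp])
  rw [map_sub, map_smul, smul_eq_mul, sub_eq_zero] at this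
  rw [this, mul_comm]

/-- If a Hermitian form agrees at pairs of distinct points of the sphere with `paramForm t` up to
a rescaling of the points, then it is a multiple of `paramForm t`. -/
theorem eq_smul_paramForm (t : Param n)
    {C : (Option (Fin n) → ℂ) →ₗ[ℂ] (Option (Fin n) → ℂ) →ₗ⋆[ℂ] ℂ}
    (hC : ∀ x y, conj (C x y) = C y x) {k : USphere (Fin n) → ℂ} (hk : ∀ z, k z ≠ 0) {m : ℂ}
    (h : ∀ z w : USphere (Fin n), z ≠ w → C (homogCoord z.1) (homogCoord w.1) =
      m * (k z * conj (k w)) * paramForm t.1 (homogCoord z.1) (homogCoord w.1))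
    (x y : Option (Fin n) → ℂ) :
    C x y = C (timeVec _) (timeVec _) * paramForm t.1 x y := by
  classical
  obtain ⟨j, hj⟩ := t.2.2.2
  have : Nonempty (Fin n) := ⟨j⟩
  set P := paramForm t.1 with hP
  set a : ℂ := ((1 - t.1 j : ℝ) : ℂ) with ha
  have ha0 : a ≠ 0 := Complex.ofReal_ne_zero.2 fun h0 => hj (by linarith)
  let w : ℂ → EuclideanSpace ℂ (Fin n) := fun c => EuclideanSpace.single j c
  -- The two points ±e_j with t_j ≠ 1: this condition makes the linear forms P(·, w₁) and P(·, w₂)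
  -- independent.
  let w₁ : USphere (Fin n) := ⟨w 1, by simp [w]⟩
  let w₂ : USphere (Fin n) := ⟨w (-1), by simp [w]⟩
  have hPw : ∀ (c : ℂ) x, P x (homogCoord (w c)) = x none + a * (x (some j) * conj c) := by
    intro c x
    simp only [hP, paramForm_apply, homogCoord_none, homogCoord_some, w, map_one, mul_one]
    rw [Finset.sum_eq_single j]
    · simp [ha]
    · intro i _ hi; simp [hi]
    · simp
  have hk' : ∀ z, conj (k z) ≠ 0 := fun z => (map_ne_zero _).2 (hk z)
  -- Comparing two second arguments eliminates `k z`. Both sides are then holomorphic and quadratic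
  -- in the first argument, and the identity spreads from the sphere without two points to the whole
  -- space.
  have hcross : ∀ (w w' : USphere (Fin n)) x,
      conj (k w') * C x (homogCoord w.1) * P x (homogCoord w'.1) =
        conj (k w) * C x (homogCoord w'.1) * P x (homogCoord w.1) := by
    intro w w' x
    have := bilinear_eq_zero_of_lift
      ((conj (k w') • C.flip (homogCoord w.1)).smulRight (P.flip (homogCoord w'.1)) -
        (conj (k w) • C.flip (homogCoord w'.1)).smulRight (P.flip (homogCoord w.1)))
      (bad := {w, w'}) (by simp) (fun z hz => by
        simp only [Set.mem_insert_iff, Set.mem_singleton_iff, not_or] at hz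
        simp only [LinearMap.sub_apply, LinearMap.smulRight_apply, LinearMap.smul_apply,
          LinearMap.flip_apply, smul_eq_mul, h z w hz.1, h z w' hz.2]
        ring) x
    simpa [sub_eq_zero] using this
  have h₁ : ∀ x, C x (homogCoord w₁.1) = C (timeVec _) (homogCoord w₁.1) * P x (homogCoord w₁.1) :=
    linear_eq_smul_of_cross (a₁ := C.flip (homogCoord w₁.1)) (a₂ := C.flip (homogCoord w₂.1))
      (b₁ := P.flip (homogCoord w₁.1)) (b₂ := P.flip (homogCoord w₂.1)) (hk' w₂)
      (hcross w₁ w₂) (p := timeVec _) (q := timeVec _ - a⁻¹ • Pi.single (some j) 1)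
      (by simp [hP]) (by
        change P _ (homogCoord (w 1)) = 0
        rw [hPw]; simp [ha0]) (by
        change P _ (homogCoord (w (-1))) ≠ 0
        rw [hPw]; simp [ha0])
  have h₂ : ∀ (v : USphere (Fin n)) x,
      C x (homogCoord v.1) = C (timeVec _) (homogCoord v.1) * P x (homogCoord v.1) := by
    intro v x
    have hz : ∀ y, P y (homogCoord w₁.1) * (conj (k w₁) * C y (homogCoord v.1) -
        conj (k v) * C (timeVec _) (homogCoord w₁.1) * P y (homogCoord v.1)) = 0 := by
      intro y
      have := hcross v w₁ y
      rw [h₁ y] at this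
      linear_combination this
    have hz' : ∀ y, conj (k w₁) * C y (homogCoord v.1) -
        conj (k v) * C (timeVec _) (homogCoord w₁.1) * P y (homogCoord v.1) = 0 :=
      eq_zero_of_mul_eq_zero (f := P.flip (homogCoord w₁.1))
        (g := conj (k w₁) • C.flip (homogCoord v.1) -
          (conj (k v) * C (timeVec _) (homogCoord w₁.1)) • P.flip (homogCoord v.1))
        (w := timeVec _) (by simp [hP]) (fun c => by simpa using hz c)
    have e1 := hz' x
    have e2 := hz' (timeVec _)
    rw [hP, paramForm_timeVec_left, homogCoord_none, map_one] at e2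
    refine mul_left_cancel₀ (hk' w₁) ?_
    linear_combination e1 - P x (homogCoord v.1) * e2
  have h₂' : ∀ (v : USphere (Fin n)) x,
      C (homogCoord v.1) x = C (homogCoord v.1) (timeVec _) * P (homogCoord v.1) x := by
    intro v x
    rw [← hC, h₂, map_mul, hC, hP, conj_paramForm]
  -- Computing C(z, v) by `h₂` and by `h₂'` and cancelling P(z, v) gives an identity linear in z;
  -- its value at `timeVec` is the claim.
  have h₃ : ∀ v : USphere (Fin n),
      C (timeVec _) (homogCoord v.1) = C (timeVec _) (timeVec _) := by
    intro v
    have := linear_eq_zero_of_lift (φ := P.flip (homogCoord v.1))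
      (ψ := C (timeVec _) (homogCoord v.1) • LinearMap.proj none - C.flip (timeVec _))
      (bad := ∅) (by simp) (fun z _ => by
        have e1 := h₂ v (homogCoord z.1)
        have e2 := h₂' z (homogCoord v.1)
        simp only [LinearMap.sub_apply, LinearMap.smul_apply, LinearMap.flip_apply,
          LinearMap.proj_apply, homogCoord_none, smul_eq_mul]
        linear_combination e2 - e1) (p := timeVec _) (by simp [hP]) (timeVec _)
    simpa [sub_eq_zero] using this
  have h₄ : ∀ (v : USphere (Fin n)),
      C x (homogCoord v.1) = C (timeVec _) (timeVec _) * P x (homogCoord v.1) := fun v => by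
    rw [h₂, h₃]
  have h₅ := linear_eq_zero_of_lift (φ := LinearMap.proj none)
    (ψ := C.flip x - C (timeVec _) (timeVec _) • P.flip x) (bad := ∅) (by simp) (fun z _ => by
      have e : C (homogCoord z.1) x = C (timeVec _) (timeVec _) * P (homogCoord z.1) x := by
        rw [← hC, h₄, map_mul, hC, hP, conj_paramForm]
      simp [e]) (p := timeVec _) (by simp) y
  have h₆ : C y x = C (timeVec _) (timeVec _) * P y x := by
    simpa [sub_eq_zero] using h₅
  rw [← hC, h₆, map_mul, hC, hP, conj_paramForm]

/-- Dividing the kernels by the nonzero products ⟨z, w⟩ for z ≠ w relates the quotient forms up to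
rescaling of points, so the linear lift of the source automorphism carries one form to K times the
other and the Lorentz form to l times itself. The operators representing the forms are then
conjugate up to K / l. -/
theorem GramRel.param_eq (hn : 2 ≤ n) {s t : Param n}
    (h : GramRel (familyMap s) (familyMap t)) : s = t := by
  classical
  obtain ⟨χ, c, m, hχ, hc, hm, h⟩ := h
  obtain ⟨L, l, hl, hL, hLz⟩ := hχ.exists_linear
  choose d hd hLd using hLz
  have : Nontrivial (Fin n) := Fin.nontrivial_iff_two_le.2 hn
  have hl' : (l : ℂ) ≠ 0 := Complex.ofReal_ne_zero.2 hl
  set C := pullbackForm (paramForm s.1) L.toLinearMap with hCdef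
  have hCa : ∀ x y, C x y = paramForm s.1 (L x) (L y) := fun x y => rfl
  have hCh : ∀ x y, conj (C x y) = C y x := fun x y => conj_paramForm _ _ _
  have hrel : ∀ z w : USphere (Fin n), z ≠ w → C (homogCoord z.1) (homogCoord w.1) =
      (m / l : ℂ) * ((c z * d z ^ 2) * conj (c w * d w ^ 2)) *
        paramForm t.1 (homogCoord z.1) (homogCoord w.1) := by
    intro z w hzw
    have hJ : lorentz (homogCoord z.1) (homogCoord w.1) ≠ 0 :=
      fun h0 => hzw (eq_of_lorentz_lift_eq_zero h0)
    have h1 := h z w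
    rw [lorentz_familyMap, lorentz_familyMap] at h1
    have h2 := hL (homogCoord z.1) (homogCoord w.1)
    rw [hCa]
    rw [hLd, hLd] at h2 ⊢
    simp only [map_smul, LinearMap.smul_apply, map_smulₛₗ, smul_eq_mul] at h2 ⊢
    refine mul_left_cancel₀ (mul_ne_zero hl' hJ) ?_
    rw [map_mul, map_pow]
    have e : (l : ℂ) * (m / l) = m := mul_div_cancel₀ _ hl'
    linear_combination (- (conj (d w) * (d z * paramForm s.1 (homogCoord (χ z).1)
      (homogCoord (χ w).1)))) * h2 + (d z * conj (d w)) ^ 2 * h1 -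
      lorentz (homogCoord z.1) (homogCoord w.1) * (c z * d z ^ 2 * (conj (c w) * conj (d w) ^ 2)) *
        paramForm t.1 (homogCoord z.1) (homogCoord w.1) * e
  have hform := eq_smul_paramForm t hCh (fun z => mul_ne_zero (hc z) (pow_ne_zero 2 (hd z))) hrel
  set K := C (timeVec _) (timeVec _) with hK
  have hKre : ((K.re : ℝ) : ℂ) = K := ofReal_re_of_hermitian hCh _
  have hKpos : 0 < K.re := by
    obtain ⟨j⟩ : Nonempty (Fin n) := inferInstance
    let z : USphere (Fin n) := ⟨EuclideanSpace.single j 1, by simp⟩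
    have h1 := hform (homogCoord z.1) (homogCoord z.1)
    have h2 : C (homogCoord z.1) (homogCoord z.1) = ((‖d z‖ ^ 2 : ℝ) : ℂ) *
        paramForm s.1 (homogCoord (χ z).1) (homogCoord (χ z).1) := by
      rw [hCa, hLd]
      simp only [map_smul, LinearMap.smul_apply, map_smulₛₗ, smul_eq_mul]
      push_cast
      rw [← Complex.mul_conj']
      ring
    rw [h2, ← hKre] at h1
    have h3 := congrArg Complex.re h1
    rw [Complex.re_ofReal_mul, Complex.re_ofReal_mul] at h3
    have h4 := one_le_paramForm_lift s.2.2.1 (χ z).1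
    have h5 := one_le_paramForm_lift t.2.2.1 z.1
    have h6 : 0 < ‖d z‖ ^ 2 := by have := hd z; positivity
    have h7 : 0 < K.re * (paramForm t.1 (homogCoord z.1) (homogCoord z.1)).re := by
      rw [← h3]; exact mul_pos h6 (by linarith)
    exact pos_of_mul_pos_left h7 (by linarith)
  -- A negative factor would turn two orthogonal spacelike basis vectors into orthogonal timelike
  -- ones; this needs n ≥ 2.
  have hlpos : 0 < l := by
    by_contra! hneg
    obtain ⟨i, j, hij⟩ := exists_pair_ne (Fin n)
    have hpos : ∀ i : Fin n, 0 < (lorentz (L (Pi.single (some i) 1))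
        (L (Pi.single (some i) 1))).re := by
      intro i
      rw [hL, lorentz_single_some]
      simpa using lt_of_le_of_ne hneg hl
    have := eq_zero_of_orthogonal_of_pos (by
      rw [hL, lorentz_single_ne (by simpa using hij), mul_zero]) (hpos i) (hpos j).le
    have h2 := hpos j
    rw [this] at h2
    simp at h2
  refine Param.eq_of_conj (div_pos hKpos hlpos) L fun x => ?_
  rw [← sub_eq_zero]
  refine eq_zero_of_lorentz_eq_zero fun y => ?_
  obtain ⟨y, rfl⟩ := L.surjective y
  rw [map_sub, map_smul, LinearMap.sub_apply, LinearMap.smul_apply, lorentz_paramOp, ← hCa, hform,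
    hL, lorentz_paramOp, Complex.ofReal_div, hKre, smul_eq_mul]
  field_simp
  ring

end Uniqueness

/-! ### Realization of Gram kernels by family maps and monomial maps. -/

section Existence

variable {n : ℕ}

/-- The Gram kernel of a rational map of degree two is that of a map of the family, up to an
automorphism of the source and a rescaling of the lifts. -/
theorem exists_gram_eq (hn : 2 ≤ n) {N : ℕ} {f : USphere (Fin n) → USphere (Fin N)}
    (hf : IsRationalOfDegree f 2) :
    ∃ (t : Param n) (χ : USphere (Fin n) ≃ USphere (Fin n)) (c : USphere (Fin n) → ℂ),
      IsSphereAut χ ∧ (∀ z, c z ≠ 0) ∧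
      Nat.card {i : FamilyIndex n // familyCoeff t.1 i ≠ 0} ≤ N ∧
      ∀ z w, c z * conj (c w) * lorentz (homogCoord (f (χ z)).1) (homogCoord (f (χ w)).1) =
        lorentz (homogCoord (familyMap t z).1) (homogCoord (familyMap t w).1) := by
  obtain ⟨B, hB, hI, hBf⟩ := exists_quadratic_lift hf
  obtain ⟨A, hA, hAB⟩ := exists_quotient_form hB fun x hx => by
    by_cases hx0 : x = 0
    · simp [hx0]
    obtain ⟨z, hz⟩ := exists_lift_of_null hx hx0
    obtain ⟨c, hc⟩ := hBf z
    rw [hz]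
    simp [hc, lorentz_lift_self]
  have hQ : IsQuotient B A := ⟨hB, hA, polarized hB hAB⟩
  obtain ⟨M, μ, t, hM, hμ, hAM⟩ := hQ.exists_param hn hI
  obtain ⟨χ, hχ, hMχ⟩ := exists_isSphereAut M hM
  choose d hd hMd using hMχ
  choose b hb using hBf
  have hμ' : (μ : ℂ) ≠ 0 := Complex.ofReal_ne_zero.2 hμ.ne'
  have hlift : ∀ z : USphere (Fin n), B (M (homogCoord z.1)) (M (homogCoord z.1)) =
      (d z ^ 2 * b (χ z)) • homogCoord (f (χ z)).1 := by
    intro z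
    rw [hMd, map_smul, map_smul, LinearMap.smul_apply, hb]
    module
  have hgram : ∀ z w : Option (Fin n) → ℂ, lorentz (B (M z) (M z)) (B (M w) (M w)) =
      lorentz z w * (μ * paramForm t.1 z w) := by
    intro z w
    rw [hAB, hM, hAM, paramForm_apply]
  -- The product of this lift with the image of `timeVec` is μ ≠ 0, so the lift is nonzero at every
  -- point of the sphere. In particular the denominator has no zeros there.
  have hne : ∀ z, d z ^ 2 * b (χ z) ≠ 0 := by
    intro z h0
    have h1 := hgram (homogCoord z.1) (timeVec _)
    rw [hlift, h0, zero_smul] at h1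
    simp [hμ'.symm] at h1
  set r : ℝ := √μ with hr
  have hr0 : (r : ℂ) ≠ 0 := Complex.ofReal_ne_zero.2 (Real.sqrt_pos.2 hμ).ne'
  have hr2 : (r : ℂ) * r = μ := by rw [← Complex.ofReal_mul, hr, Real.mul_self_sqrt hμ.le]
  refine ⟨t, χ, fun z => d z ^ 2 * b (χ z) / r, hχ, fun z => div_ne_zero (hne z) hr0,
    hQ.card_le hM hμ hAM, fun z w => ?_⟩
  have h1 := hgram (homogCoord z.1) (homogCoord w.1)
  rw [hlift, hlift, ← hr2] at h1
  simp only [map_smul, LinearMap.smul_apply, map_smulₛₗ, smul_eq_mul] at h1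
  rw [lorentz_familyMap, map_div₀, Complex.conj_ofReal]
  field_simp
  linear_combination h1

/-- At two distinct basis vectors both factors of the kernel equal 1. Witt's theorem needs such a
pair of points with distinct images. -/
theorem exists_familyMap_ne (hn : 2 ≤ n) (t : Param n) :
    ∃ a b : USphere (Fin n),
      lorentz (homogCoord (familyMap t a).1) (homogCoord (familyMap t b).1) ≠ 0 := by
  have : Nontrivial (Fin n) := Fin.nontrivial_iff_two_le.2 hn
  obtain ⟨i, j, hij⟩ := exists_pair_ne (Fin n)
  refine ⟨⟨EuclideanSpace.single i 1, by simp⟩, ⟨EuclideanSpace.single j 1, by simp⟩, ?_⟩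
  have hz : ∀ k, (EuclideanSpace.single i (1 : ℂ) : EuclideanSpace ℂ (Fin n)) k *
      conj ((EuclideanSpace.single j (1 : ℂ) : EuclideanSpace ℂ (Fin n)) k) = 0 := by
    intro k
    rcases eq_or_ne k i with rfl | h
    · simp [hij]
    · simp [h]
  rw [lorentz_familyMap, lorentz_homogCoord, paramForm_apply]
  simp only [homogCoord_none, homogCoord_some, hz]
  simp

/-- The components of the maps of the family are monomials. -/
theorem familyVec_monomial (t : Fin n → ℝ) (i : FamilyIndex n) :
    ∃ (c : ℂ) (α : Fin n → ℕ), ∀ z : EuclideanSpace ℂ (Fin n),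
      familyVec t z i = c * ∏ j, z j ^ α j := by
  classical
  have hsingle : ∀ (z : EuclideanSpace ℂ (Fin n)) j k,
      ∏ l, z l ^ (Pi.single j k : Fin n → ℕ) l = z j ^ k := by
    intro z j k
    rw [Finset.prod_eq_single j (fun l _ hl => by simp [hl]) (by simp), Pi.single_eq_same]
  rcases i with j | j | p
  · exact ⟨√(t j), Pi.single j 1, fun z => by rw [hsingle]; simp [familyVec]⟩
  · exact ⟨√(1 - t j), Pi.single j 2, fun z => by rw [hsingle]; simp [familyVec]⟩
  · refine ⟨√(2 - t p.1.1 - t p.1.2), Pi.single p.1.1 1 + Pi.single p.1.2 1, fun z => ?_⟩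
    simp only [Pi.add_apply, pow_add, Finset.prod_mul_distrib, hsingle, pow_one]
    simp [familyVec]

theorem familyVec_eq_zero_of_coeff (t : Fin n → ℝ) {i : FamilyIndex n} (hi : familyCoeff t i = 0)
    (z : EuclideanSpace ℂ (Fin n)) : familyVec t z i = 0 := by
  rcases i with j | j | p <;> simp only [familyCoeff, Sum.elim_inl, Sum.elim_inr] at hi <;>
    simp [familyVec, hi]

/-- A map of the family can be realized by a monomial map into a sphere whose dimension is the
number of its nonzero components. -/
theorem exists_monomial_gram_eq (t : Param n) {N : ℕ}
    (hN : Nat.card {i : FamilyIndex n // familyCoeff t.1 i ≠ 0} ≤ N) :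
    ∃ g : USphere (Fin n) → USphere (Fin N), IsMonomial g ∧
      ∀ z w, lorentz (homogCoord (g z).1) (homogCoord (g w).1) =
        lorentz (homogCoord (familyMap t z).1) (homogCoord (familyMap t w).1) := by
  classical
  obtain ⟨e⟩ : Nonempty ({i : FamilyIndex n // familyCoeff t.1 i ≠ 0} ↪ Fin N) :=
    Function.Embedding.nonempty_of_card_le (by
      rwa [Fintype.card_fin, ← Nat.card_eq_fintype_card])
  -- Only the components with nonzero coefficient are placed; the others vanish identically and do
  -- not affect the kernel.
  let G : EuclideanSpace ℂ (Fin n) → EuclideanSpace ℂ (Fin N) := fun z =>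
    WithLp.toLp 2 (Function.extend e (fun i => familyVec t.1 z i.1) 0)
  have hG1 : ∀ z i, G z (e i) = familyVec t.1 z i.1 := fun z i =>
    e.injective.extend_apply (fun i => familyVec t.1 z i.1) 0 i
  have hG0 : ∀ z k, (¬ ∃ i, e i = k) → G z k = 0 := fun z k hk =>
    Function.extend_apply' (fun i => familyVec t.1 z i.1) (0 : Fin N → ℂ) k hk
  have hG : ∀ z w, lorentz (homogCoord (G z)) (homogCoord (G w)) =
      lorentz (homogCoord (familyVec t.1 z)) (homogCoord (familyVec t.1 w)) := by
    intro z w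
    rw [lorentz_homogCoord, lorentz_homogCoord]
    congr 1
    trans ∑ i : {i : FamilyIndex n // familyCoeff t.1 i ≠ 0},
      familyVec t.1 z i.1 * conj (familyVec t.1 w i.1)
    · symm
      refine Fintype.sum_of_injective e e.injective _ _ (fun k hk => ?_) fun i => by
        rw [hG1, hG1]
      rw [hG0 z k fun ⟨i, hi⟩ => hk ⟨i, hi⟩, zero_mul]
    · refine Fintype.sum_of_injective _ Subtype.val_injective _ _ (fun k hk => ?_) fun i => rfl
      rw [familyVec_eq_zero_of_coeff t.1 (by simpa using hk), zero_mul]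
  have hGs : ∀ z : USphere (Fin n), G z.1 ∈ Metric.sphere (0 : EuclideanSpace ℂ (Fin N)) 1 := by
    intro z
    have h1 := (hG z.1 z.1).trans (lorentz_lift_self (familyMap t z))
    rw [lorentz_homogCoord_self, Complex.ofReal_eq_zero] at h1
    rw [mem_sphere_zero_iff_norm]
    exact (pow_eq_one_iff_of_nonneg (norm_nonneg _) two_ne_zero).1 (by linarith)
  refine ⟨fun z => ⟨G z.1, hGs z⟩, fun k => ?_, fun z w => hG z.1 w.1⟩
  by_cases hk : ∃ i, e i = k
  · obtain ⟨i, rfl⟩ := hk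
    obtain ⟨c, α, h⟩ := familyVec_monomial t.1 i.1
    exact ⟨c, α, fun z => (hG1 z.1 i).trans (h z.1)⟩
  · exact ⟨0, 0, fun z => by simpa using hG0 z.1 k hk⟩

/-- Two maps into the same sphere whose Gram kernels agree up to an automorphism of the source and
a rescaling of the lifts are spherically equivalent. -/
theorem sphEquivSameTarget_of_gram_eq {σ κ : Type} [Fintype σ] [Fintype κ]
    {f g : USphere σ → USphere κ} {χ : USphere σ ≃ USphere σ} (hχ : IsSphereAut χ)
    {c : USphere σ → ℂ} (hc : ∀ z, c z ≠ 0)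
    (h : ∀ z w, c z * conj (c w) * lorentz (homogCoord (f (χ z)).1) (homogCoord (f (χ w)).1) =
      lorentz (homogCoord (g z).1) (homogCoord (g w).1)) {a b : USphere σ}
    (hab : lorentz (homogCoord (g a).1) (homogCoord (g b).1) ≠ 0) : SphEquivSameTarget f g := by
  obtain ⟨τ, hτ, hτg⟩ := exists_isSphereAut_of_gram_eq (fun z => f (χ z)) g c hc h (a := a) (b := b)
    fun h0 => hab (by rw [h0, lorentz_lift_self])
  exact ⟨χ, τ, hχ, hτ, funext hτg⟩

end Existence

end CRSphere

/-! ### The classification theorem. -/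

open CRSphere
theorem theorem1p3 (n : ℕ) (hn : 2 ≤ n) :
    (∀ (N : ℕ) (f : USphere (Fin n) → USphere (Fin N)),
      IsCR f → IsRationalOfDegree f 2 →
        (∃ g : USphere (Fin n) → USphere (Fin N), IsMonomial g ∧ SphEquivSameTarget f g) ∧
        ∃! t : Param n, SphericallyEquivalent f (familyMap t)) ∧
    (∀ s t : Param n, s ≠ t → ¬ SphericallyEquivalent (familyMap s) (familyMap t)) := by
  refine ⟨fun N f _ hf => ?_, fun s t hst h => hst (h.gramRel.param_eq hn)⟩
  obtain ⟨t, χ, c, hχ, hc, hN, h⟩ := exists_gram_eq hn hf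
  obtain ⟨a, b, hab⟩ := exists_familyMap_ne hn t
  constructor
  · obtain ⟨g, hg, hgt⟩ := exists_monomial_gram_eq t hN
    exact ⟨g, hg, sphEquivSameTarget_of_gram_eq hχ hc (fun z w => (h z w).trans (hgt z w).symm)
      (a := a) (b := b) (by rwa [hgt])⟩
  -- Padding with zeros preserves the Gram kernel, so it may be applied to whichever target is
  -- smaller. For uniqueness, the relations of `f` to both family maps are composed.
  · refine ⟨t, ?_, fun s hs => (hs.gramRel.symm.trans ?_ : GramRel (familyMap s) _).param_eq hn⟩
    · rcases le_total (Fintype.card (Fin N)) (Fintype.card (FamilyIndex n)) with hle | hle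
      · obtain ⟨e⟩ := Function.Embedding.nonempty_of_card_le hle
        exact Or.inl ⟨e, sphEquivSameTarget_of_gram_eq hχ hc
          (fun z w => by rw [lorentz_zeroExtend, h]) hab⟩
      · obtain ⟨e⟩ := Function.Embedding.nonempty_of_card_le hle
        exact Or.inr ⟨e, sphEquivSameTarget_of_gram_eq hχ hc
          (fun z w => by rw [lorentz_zeroExtend, h]) (by rwa [lorentz_zeroExtend])⟩
    · refine ⟨χ, fun z => (c z)⁻¹, 1, hχ, fun z => inv_ne_zero (hc z), one_ne_zero, fun z w => ?_⟩
      have h1 := hc z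
      have h2 : starRingEnd ℂ (c w) ≠ 0 := (map_ne_zero _).2 (hc w)
      rw [← h, map_inv₀]
      field_simp
      simp
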